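/- All quantum systems are finite-dimensional (of nonzero dimension), states are density matrices and Hamiltonians are Hermitian matrices. For a Hamiltonian $H$ and a real $b$ let $\gamma_b^{\mathrm{Gibbs}}(H)=e^{-bH}/\operatorname{tr}(e^{-bH})$. For real $e$ let $[e]_H$ be the set of density matrices $\rho$ with $\operatorname{tr}(\rho H)=e$. If $[e]_H$ is non-empty, the canonical ensemble $\gamma_e(H)$ of the macrostate $(e,H)$ is the Gibbs state of $H$ of mean energy $e$; if $H$ is not a multiple of the identity and $e$ is its smallest or largest eigenvalue, it is the limit of $\gamma_b^{\mathrm{Gibbs}}(H)$ as $b\to+\infty$ or $b\to-\infty$, respectively. Fix a real $\beta$. An environment is a finite family of systems $E^1,\dots,E^N$ of arbitrary dimensions with arbitrary Hamiltonians $H_{E^i}$; write $e_\beta(H_{E^i})=\operatorname{tr}\big(\gamma_\beta^{\mathrm{Gibbs}}(H_{E^i})H_{E^i}\big)$ and $H_{SE}=H\otimes 1+1\otimes\sum_i H_{E^i}$, where $H_{E^i}$ acts on the $i$-th tensor factor of the environment. A state $\rho_f$ of the system $S$ can be reached by macrostate operations from $(e,H)$, written $(e,H)\overset{\beta\text{-mac}}{\longrightarrow}\rho_f$,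 if for all $\epsilon,\epsilon'>0$ there are an environment and a unitary $U$ on $SE$ such that for every $\rho\in[e]_H$ and all $\rho_{E^i}\in[e_\beta(H_{E^i})]_{H_{E^i}}$, with $\rho_{SE}=\rho\otimes\rho_{E^1}\otimes\dots\otimes\rho_{E^N}$, $$\big\|\rho_f-\operatorname{tr}_E(U\rho_{SE}U^\dagger)\big\|_1\le\epsilon,\qquad \big|\operatorname{tr}(U\rho_{SE}U^\dagger H_{SE})-\operatorname{tr}(\rho_{SE}H_{SE})\big|\le\epsilon' .$$ A state $\rho_f$ can be reached by microstate operations from a state $\rho$ of $S$, written $\rho\overset{\beta\text{-mic}}{\longrightarrow}\rho_f$, if for all $\epsilon,\epsilon'>0$ there are an environment and a unitary $U$ on $SE$ such that these two inequalities hold for the single state $\rho_{SE}=\rho\otimes\gamma_\beta^{\mathrm{Gibbs}}(H_{E^1})\otimes\dots\otimes\gamma_\beta^{\mathrm{Gibbs}}(H_{E^N})$. Theorem (Equivalence with the canonical ensemble). Let $\beta\neq0$ and let $(e,H)$ be a macrostate of $S$ with $[e]_H\neq\emptyset$. Then the canonical ensemble $\gamma_e(H)$ exists and $(e,H)\sim_\beta\gamma_e(H)$,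 that is, for every state $\rho_f$ of $S$, $$(e,H)\overset{\beta\text{-mac}}{\longrightarrow}\rho_f\iff\gamma_e(H)\overset{\beta\text{-mic}}{\longrightarrow}\rho_f .$$ -/

import Mathlib

open scoped ComplexOrder Kronecker Matrix Topology
open Filter

/-- `ρ` is a density matrix: positive semidefinite of trace one. -/
def IsDensityMatrix {n : Type*} [Fintype n] (ρ : Matrix n n ℂ) : Prop :=
  ρ.PosSemidef ∧ ρ.trace = 1

/-- The mean energy `tr (ρ H)` of `ρ` with respect to the Hamiltonian `H`
(a real number when `ρ` and `H` are Hermitian). -/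
noncomputable def meanEnergy {n : Type*} [Fintype n] (H ρ : Matrix n n ℂ) : ℝ :=
  (ρ * H).trace.re

/-- The equivalence class `[e]_H` of the macrostate `(e, H)`: all density matrices of mean
energy `e` with respect to `H`. -/
def microstates {n : Type*} [Fintype n] (e : ℝ) (H : Matrix n n ℂ) : Set (Matrix n n ℂ) :=
  {ρ | IsDensityMatrix ρ ∧ meanEnergy H ρ = e}

/-- The Gibbs state `exp (-b H) / tr (exp (-b H))` at inverse temperature `b`. -/
noncomputable def gibbs {n : Type*} [Fintype n] [DecidableEq n] (b : ℝ) (H : Matrix n n ℂ) :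
    Matrix n n ℂ :=
  (NormedSpace.exp (-(b : ℂ) • H)).trace⁻¹ • NormedSpace.exp (-(b : ℂ) • H)

/-- The thermal energy `e_β(H)`: the mean energy of the Gibbs state at inverse temperature `β`. -/
noncomputable def thermalEnergy {n : Type*} [Fintype n] [DecidableEq n] (β : ℝ)
    (H : Matrix n n ℂ) : ℝ :=
  meanEnergy H (gibbs β H)

/-- `γ` is the canonical ensemble `γ_e(H)` of the macrostate `(e, H)`: the Gibbs state of mean
energy `e`, at an inverse temperature in `[-∞, ∞]`. The values `±∞`, read as limits of Gibbs
states, occur when `e` is the least or the greatest eigenvalue of `H` and `H` is not a scalar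
matrix; for all other attainable `e` the inverse temperature is a real number. -/
def IsCanonicalEnsemble {n : Type*} [Fintype n] [DecidableEq n] (e : ℝ) (H γ : Matrix n n ℂ) :
    Prop :=
  meanEnergy H γ = e ∧
    ((∃ b : ℝ, γ = gibbs b H) ∨ Tendsto (fun b : ℝ => gibbs b H) atTop (𝓝 γ) ∨
      Tendsto (fun b : ℝ => gibbs b H) atBot (𝓝 γ))

/-- The trace norm `‖A‖₁ = tr √(Aᴴ A)`, the sum of the singular values of `A`. -/
noncomputable def traceNorm {n : Type*} [Fintype n] [DecidableEq n] (A : Matrix n n ℂ) : ℝ :=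
  ∑ i, Real.sqrt ((Matrix.isHermitian_conjTranspose_mul_self A).eigenvalues i)

/-- The partial trace over the second tensor factor. -/
def partialTrace {m n : Type*} [Fintype n] (A : Matrix (m × n) (m × n) ℂ) : Matrix m m ℂ :=
  Matrix.of fun i j => ∑ k, A (i, k) (j, k)

/-- The tensor product of a finite family of matrices, acting on the tensor product of the
factors (with the product basis). -/
def tensorProd {ι : Type*} [Fintype ι] {X : ι → Type*}
    (A : ∀ i, Matrix (X i) (X i) ℂ) : Matrix (∀ i, X i) (∀ i, X i) ℂ :=
  Matrix.of fun x y => ∏ i, A i (x i) (y i)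

/-- An environment: finitely many quantum systems of finite nonzero dimension (an orthonormal
basis of system `i` is labelled by `X i`), each with its own Hamiltonian. -/
structure Environment where
  /-- labels of the systems -/
  ι : Type
  [fintypeLabel : Fintype ι]
  [decEqLabel : DecidableEq ι]
  /-- labels of an orthonormal basis of each system -/
  X : ι → Type
  [fintypeBasis : ∀ i, Fintype (X i)]
  [decEqBasis : ∀ i, DecidableEq (X i)]
  [nonemptyBasis : ∀ i, Nonempty (X i)]
  /-- the Hamiltonian of each system -/
  ham : ∀ i, Matrix (X i) (X i) ℂ
  isHermitian_ham : ∀ i, (ham i).IsHermitian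

attribute [instance] Environment.fintypeLabel Environment.decEqLabel Environment.fintypeBasis
  Environment.decEqBasis Environment.nonemptyBasis

/-- The basis labels of the whole environment. -/
abbrev Environment.Basis (E : Environment) : Type := ∀ i, E.X i

/-- The Hamiltonian of the environment: the sum over its systems of
`1 ⊗ ⋯ ⊗ H_i ⊗ ⋯ ⊗ 1`. -/
noncomputable def Environment.totalHam (E : Environment) : Matrix E.Basis E.Basis ℂ :=
  ∑ i, tensorProd
    (Function.update (fun j => (1 : Matrix (E.X j) (E.X j) ℂ)) i (E.ham i))

/-- The Hamiltonian `H ⊗ 1 + 1 ⊗ H_E` of the compound of system and environment. -/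
noncomputable def Environment.jointHam {n : Type*} [DecidableEq n] (E : Environment)
    (H : Matrix n n ℂ) : Matrix (n × E.Basis) (n × E.Basis) ℂ :=
  H ⊗ₖ (1 : Matrix E.Basis E.Basis ℂ) + (1 : Matrix n n ℂ) ⊗ₖ E.totalHam

/-- Applied to the initial system state `ρ` and the initial states `σ i` of the environment
systems, the evolution `U` brings the system `ε`-close to `ρf` in trace norm and changes the mean
energy of the compound by at most `ε'`. -/
def Achieves {n : Type*} [Fintype n] [DecidableEq n] (E : Environment) (H : Matrix n n ℂ)
    (U : Matrix (n × E.Basis) (n × E.Basis) ℂ) (ρ : Matrix n n ℂ)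
    (σ : ∀ i, Matrix (E.X i) (E.X i) ℂ) (ρf : Matrix n n ℂ) (ε ε' : ℝ) : Prop :=
  traceNorm (ρf - partialTrace (U * (ρ ⊗ₖ tensorProd σ) * Uᴴ)) ≤ ε ∧
    |meanEnergy (E.jointHam H) (U * (ρ ⊗ₖ tensorProd σ) * Uᴴ) -
      meanEnergy (E.jointHam H) (ρ ⊗ₖ tensorProd σ)| ≤ ε'

/-- `ρf` can be reached from the macrostate `(e, H)` by macrostate operations: a single unitary
works for all microstates of the system and of the environment systems. -/
def MacReachable {n : Type*} [Fintype n] [DecidableEq n] (β e : ℝ) (H ρf : Matrix n n ℂ) :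
    Prop :=
  ∀ ε > 0, ∀ ε' > 0, ∃ E : Environment, ∃ U ∈ Matrix.unitaryGroup (n × E.Basis) ℂ,
    ∀ ρ ∈ microstates e H, ∀ σ : ∀ i, Matrix (E.X i) (E.X i) ℂ,
      (∀ i, σ i ∈ microstates (thermalEnergy β (E.ham i)) (E.ham i)) →
        Achieves E H U ρ σ ρf ε ε'

/-- `ρf` can be reached from the microstate `ρ` by microstate operations, the system having the
Hamiltonian `H`. -/
def MicReachable {n : Type*} [Fintype n] [DecidableEq n] (β : ℝ) (H ρ ρf : Matrix n n ℂ) :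
    Prop :=
  ∀ ε > 0, ∀ ε' > 0, ∃ E : Environment, ∃ U ∈ Matrix.unitaryGroup (n × E.Basis) ℂ,
    Achieves E H U ρ (fun i => gibbs β (E.ham i)) ρf ε ε'

/-- Operational equivalence `(e, H) ∼_β ρ`: the same final states can be reached. -/
def OperationallyEquivalent {n : Type*} [Fintype n] [DecidableEq n] (β e : ℝ)
    (H ρ : Matrix n n ℂ) : Prop :=
  ∀ ρf : Matrix n n ℂ, IsDensityMatrix ρf → (MacReachable β e H ρf ↔ MicReachable β H ρ ρf)

/-
Write the canonical ensemble as `γ = exp (-b H) / tr (exp (-b H))`, restricted to an extremal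
eigenspace of `H` when `b = ±∞`. It is the Gibbs state at inverse temperature `β` of the effective
Hamiltonian `K = (b / β) H`, so an evolution conserving `K + H_E` may freely thermalize the system
towards `γ`. What it then changes in the mean energy of `H + H_E` is determined by the mean energies
of `H` and `K` before and after; those before agree on the whole macrostate `(e, H)`, so every
microstate exhibits the same energy change as `γ` itself.

Although a macrostate operation has no access to the microstates of the environment, the
populations of a qubit are fixed by its mean energy. Exchanging system levels against excitations of
qubits whose gaps match those of `K` therefore relaxes the populations of every microstate to those
of `γ` simultaneously. The coherences are removed by phases controlled by weakly polarized qubits.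
From the state so prepared, the unitary of a microstate operation reaches `ρf`.
-/

section TraceNorm

variable {n : Type*} [Fintype n] [DecidableEq n]

open scoped MatrixOrder Matrix.Norms.L2Operator in
theorem traceNorm_eq_re_trace_sqrt (A : Matrix n n ℂ) :
    traceNorm A = (CFC.sqrt (Aᴴ * A)).trace.re := by
  have hA := Matrix.isHermitian_conjTranspose_mul_self A
  rw [CFC.sqrt_eq_real_sqrt _ (Matrix.posSemidef_conjTranspose_mul_self A).nonneg,
    cfcₙ_eq_cfc, hA.cfc_eq, Matrix.IsHermitian.cfc, Unitary.conjStarAlgAut_apply]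
  rw [Matrix.trace_mul_comm, ← Matrix.mul_assoc, Unitary.coe_star_mul_self]
  simp [traceNorm, Matrix.trace]

open scoped MatrixOrder Matrix.Norms.L2Operator in
theorem continuous_traceNorm : Continuous (traceNorm : Matrix n n ℂ → ℝ) := by
  have hsqrt : Continuous fun A : Matrix n n ℂ => CFC.sqrt (Aᴴ * A) :=
    CFC.continuousOn_sqrt.comp_continuous (by fun_prop)
      fun A => (Matrix.posSemidef_conjTranspose_mul_self A).nonneg
  exact (Complex.continuous_re.comp hsqrt.matrix_trace).congr
    fun A => (traceNorm_eq_re_trace_sqrt A).symm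

end TraceNorm

section Spectral

variable {n : Type*} [Fintype n]

theorem meanEnergy_neg (H ρ : Matrix n n ℂ) : meanEnergy (-H) ρ = -meanEnergy H ρ := by
  simp [meanEnergy]

theorem meanEnergy_add (H K ρ : Matrix n n ℂ) :
    meanEnergy (H + K) ρ = meanEnergy H ρ + meanEnergy K ρ := by
  simp [meanEnergy, Matrix.mul_add]

theorem continuous_meanEnergy (H : Matrix n n ℂ) : Continuous (meanEnergy H) := by
  unfold meanEnergy
  fun_prop

theorem microstates_neg (e : ℝ) (H : Matrix n n ℂ) : microstates (-e) (-H) = microstates e H := by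
  simp [microstates, meanEnergy_neg]

theorem isClosed_isDensityMatrix : IsClosed {ρ : Matrix n n ℂ | IsDensityMatrix ρ} := by
  have hset : {ρ : Matrix n n ℂ | IsDensityMatrix ρ} =
      {ρ | ρᴴ = ρ} ∩ (⋂ x : n → ℂ, {ρ | 0 ≤ star x ⬝ᵥ ρ.mulVec x}) ∩ {ρ | ρ.trace = 1} := by
    ext ρ
    simp [IsDensityMatrix, Matrix.posSemidef_iff_dotProduct_mulVec, Matrix.IsHermitian]
  rw [hset]
  refine ((isClosed_eq (by fun_prop) (by fun_prop)).inter
    (isClosed_iInter fun x => ?_)).inter (isClosed_eq (by fun_prop) (by fun_prop))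
  exact isClosed_le continuous_const (by fun_prop)

namespace IsDensityMatrix

variable {ρ : Matrix n n ℂ}

theorem re_diag_nonneg (hρ : IsDensityMatrix ρ) (l : n) : 0 ≤ (ρ l l).re :=
  (Complex.nonneg_iff.1 hρ.1.diag_nonneg).1

theorem ofReal_re_diag (hρ : IsDensityMatrix ρ) (l : n) : ((ρ l l).re : ℂ) = ρ l l :=
  Complex.ext rfl (Complex.nonneg_iff.1 hρ.1.diag_nonneg).2

theorem sum_re_diag (hρ : IsDensityMatrix ρ) : ∑ l, (ρ l l).re = 1 := by
  simpa [Matrix.trace] using congrArg Complex.re hρ.2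

theorem nonempty (hρ : IsDensityMatrix ρ) : Nonempty n := by
  by_contra hempty
  rw [not_nonempty_iff] at hempty
  simpa using hρ.2

theorem re_diag_le_one (hρ : IsDensityMatrix ρ) (l : n) : (ρ l l).re ≤ 1 :=
  hρ.sum_re_diag ▸ Finset.single_le_sum (fun i _ => hρ.re_diag_nonneg i) (Finset.mem_univ l)

end IsDensityMatrix

theorem conj_mul_eq_conj_conj (A B X : Matrix n n ℂ) :
    A * B * X * (A * B)ᴴ = A * (B * X * Bᴴ) * Aᴴ := by
  simp only [Matrix.conjTranspose_mul, Matrix.mul_assoc]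

theorem unitary_mul_conjTranspose [DecidableEq n] {W : Matrix n n ℂ}
    (hW : W ∈ Matrix.unitaryGroup n ℂ) : W * Wᴴ = 1 :=
  Matrix.mem_unitaryGroup_iff.1 hW

theorem unitary_conjTranspose_mul [DecidableEq n] {W : Matrix n n ℂ}
    (hW : W ∈ Matrix.unitaryGroup n ℂ) : Wᴴ * W = 1 :=
  Matrix.mem_unitaryGroup_iff'.1 hW

theorem trace_conj_of_mem_unitaryGroup [DecidableEq n] {W : Matrix n n ℂ}
    (hW : W ∈ Matrix.unitaryGroup n ℂ) (A : Matrix n n ℂ) : (W * A * Wᴴ).trace = A.trace := by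
  rw [Matrix.trace_mul_comm, ← Matrix.mul_assoc, unitary_conjTranspose_mul hW, Matrix.one_mul]

theorem conjTranspose_mem_unitaryGroup [DecidableEq n] {W : Matrix n n ℂ}
    (hW : W ∈ Matrix.unitaryGroup n ℂ) : Wᴴ ∈ Matrix.unitaryGroup n ℂ :=
  Unitary.star_mem hW

theorem IsDensityMatrix.conj [DecidableEq n] {W ρ : Matrix n n ℂ} (hρ : IsDensityMatrix ρ)
    (hW : W ∈ Matrix.unitaryGroup n ℂ) : IsDensityMatrix (W * ρ * Wᴴ) :=
  ⟨hρ.1.mul_mul_conjTranspose_same W, by rw [trace_conj_of_mem_unitaryGroup hW, hρ.2]⟩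

theorem IsDensityMatrix.norm_apply_le_one {ρ : Matrix n n ℂ} (hρ : IsDensityMatrix ρ) (i j : n) :
    ‖ρ i j‖ ≤ 1 := by
  have hdet : 0 ≤ (ρ.submatrix ![i, j] ![i, j]).det := (hρ.1.submatrix _).det_nonneg
  have hentry : ρ j i = star (ρ i j) := (hρ.1.1.apply j i).symm
  have hminor : ‖ρ i j‖ ^ 2 ≤ (ρ i i).re * (ρ j j).re := by
    rw [Matrix.det_fin_two] at hdet
    simp only [Matrix.submatrix_apply, Matrix.cons_val_zero, Matrix.cons_val_one, hentry,
      RCLike.star_def, Complex.mul_conj', sub_nonneg] at hdet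
    rw [← hρ.ofReal_re_diag i, ← hρ.ofReal_re_diag j] at hdet
    exact_mod_cast hdet
  nlinarith [norm_nonneg (ρ i j), hρ.re_diag_nonneg i, hρ.re_diag_nonneg j,
    hρ.re_diag_le_one i, hρ.re_diag_le_one j]

/-- The matrix with eigenbasis given by the columns of `W` and eigenvalues `g`. -/
noncomputable def spectralMatrix [DecidableEq n] (W : Matrix n n ℂ) (g : n → ℝ) : Matrix n n ℂ :=
  W * Matrix.diagonal (fun i => (g i : ℂ)) * Wᴴ

/-- The populations of `ρ` in the basis given by the columns of `W`. -/
def population (W ρ : Matrix n n ℂ) (l : n) : ℝ := ((Wᴴ * ρ * W) l l).re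

theorem meanEnergy_spectralMatrix [DecidableEq n] (W ρ : Matrix n n ℂ) (h : n → ℝ) :
    meanEnergy (spectralMatrix W h) ρ = ∑ l, population W ρ l * h l := by
  rw [meanEnergy, spectralMatrix, ← Matrix.mul_assoc, Matrix.trace_mul_comm, ← Matrix.mul_assoc,
    ← Matrix.mul_assoc]
  simp [Matrix.trace, population]

variable [DecidableEq n] {W : Matrix n n ℂ}

theorem exists_eq_spectralMatrix {H : Matrix n n ℂ} (hH : H.IsHermitian) :
    ∃ W ∈ Matrix.unitaryGroup n ℂ, ∃ h : n → ℝ, H = spectralMatrix W h :=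
  ⟨hH.eigenvectorUnitary, hH.eigenvectorUnitary.2, hH.eigenvalues, hH.spectral_theorem⟩

theorem continuous_spectralMatrix (W : Matrix n n ℂ) : Continuous (spectralMatrix W) := by
  unfold spectralMatrix
  fun_prop

theorem spectralMatrix_neg (W : Matrix n n ℂ) (h : n → ℝ) :
    spectralMatrix W (-h) = -spectralMatrix W h := by
  have hdiag : Matrix.diagonal (fun i => (((-h) i : ℝ) : ℂ)) =
      -Matrix.diagonal fun i => (h i : ℂ) := by
    simp [Matrix.diagonal_neg]
  rw [spectralMatrix, hdiag, Matrix.mul_neg, Matrix.neg_mul, spectralMatrix]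

theorem spectralMatrix_add (W : Matrix n n ℂ) (g h : n → ℝ) :
    spectralMatrix W g + spectralMatrix W h = spectralMatrix W (g + h) := by
  rw [spectralMatrix, spectralMatrix, ← Matrix.add_mul, ← Matrix.mul_add, Matrix.diagonal_add,
    spectralMatrix]
  simp only [Pi.add_apply, Complex.ofReal_add]

theorem spectralMatrix_const_one (hW : W ∈ Matrix.unitaryGroup n ℂ) :
    spectralMatrix W (fun _ => 1) = 1 := by
  rw [spectralMatrix, Complex.ofReal_one, Matrix.diagonal_one, Matrix.mul_one,
    unitary_mul_conjTranspose hW]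

theorem population_spectralMatrix (hW : W ∈ Matrix.unitaryGroup n ℂ) (g : n → ℝ) :
    population W (spectralMatrix W g) = g := by
  have hdiag : Wᴴ * spectralMatrix W g * W = Matrix.diagonal fun i => (g i : ℂ) := by
    simp only [spectralMatrix, Matrix.mul_assoc, unitary_conjTranspose_mul hW, Matrix.mul_one]
    rw [← Matrix.mul_assoc, unitary_conjTranspose_mul hW, Matrix.one_mul]
  ext l
  simp [population, hdiag]

theorem IsDensityMatrix.population_nonneg {ρ : Matrix n n ℂ} (hρ : IsDensityMatrix ρ)
    (hW : W ∈ Matrix.unitaryGroup n ℂ) (l : n) : 0 ≤ population W ρ l := by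
  simpa [population] using (hρ.conj (conjTranspose_mem_unitaryGroup hW)).re_diag_nonneg l

theorem IsDensityMatrix.sum_population {ρ : Matrix n n ℂ} (hρ : IsDensityMatrix ρ)
    (hW : W ∈ Matrix.unitaryGroup n ℂ) : ∑ l, population W ρ l = 1 := by
  simpa [population] using (hρ.conj (conjTranspose_mem_unitaryGroup hW)).sum_re_diag

theorem isDensityMatrix_spectralMatrix (hW : W ∈ Matrix.unitaryGroup n ℂ)
    {g : n → ℝ} (hg : ∀ l, 0 ≤ g l) (hg1 : ∑ l, g l = 1) :
    IsDensityMatrix (spectralMatrix W g) := by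
  have hdiag : IsDensityMatrix (Matrix.diagonal fun i => (g i : ℂ)) :=
    ⟨Matrix.PosSemidef.diagonal fun i => Complex.zero_le_real.2 (hg i), by
      rw [Matrix.trace_diagonal]
      exact_mod_cast hg1⟩
  exact hdiag.conj hW

end Spectral

section Boltzmann

variable {m : Type*}

/-- The Boltzmann weight at inverse temperature `b` of the levels in `L`, the other levels having
weight zero. -/
noncomputable def boltzmannWeight (L : Set m) (b : ℝ) (h : m → ℝ) : m → ℝ :=
  L.indicator fun l => Real.exp (-(b * h l))

/-- The Boltzmann distribution at inverse temperature `b` restricted to the levels in `L`. With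
`L = Set.univ` it gives the populations of a Gibbs state, with the ground level for `L` those of its
limit for `b → ∞`. -/
noncomputable def boltzmann [Fintype m] (L : Set m) (b : ℝ) (h : m → ℝ) (l : m) : ℝ :=
  boltzmannWeight L b h l / ∑ i, boltzmannWeight L b h i

theorem boltzmannWeight_nonneg (L : Set m) (b : ℝ) (h : m → ℝ) (l : m) :
    0 ≤ boltzmannWeight L b h l :=
  Set.indicator_nonneg (fun _ _ => (Real.exp_pos _).le) l

theorem sum_boltzmannWeight_pos [Fintype m] {L : Set m} (hL : L.Nonempty) (b : ℝ) (h : m → ℝ) :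
    0 < ∑ l, boltzmannWeight L b h l := by
  obtain ⟨l₀, hl₀⟩ := hL
  refine Finset.sum_pos' (fun l _ => boltzmannWeight_nonneg L b h l) ⟨l₀, Finset.mem_univ l₀, ?_⟩
  simpa [boltzmannWeight, hl₀] using Real.exp_pos _

variable [Fintype m]

theorem boltzmann_nonneg (L : Set m) (b : ℝ) (h : m → ℝ) (l : m) : 0 ≤ boltzmann L b h l :=
  div_nonneg (boltzmannWeight_nonneg L b h l)
    (Finset.sum_nonneg fun i _ => boltzmannWeight_nonneg L b h i)

theorem sum_boltzmann {L : Set m} (hL : L.Nonempty) (b : ℝ) (h : m → ℝ) :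
    ∑ l, boltzmann L b h l = 1 := by
  simp only [boltzmann, ← Finset.sum_div]
  exact div_self (sum_boltzmannWeight_pos hL b h).ne'

theorem boltzmann_of_notMem {L : Set m} (b : ℝ) (h : m → ℝ) {l : m} (hl : l ∉ L) :
    boltzmann L b h l = 0 := by
  simp [boltzmann, boltzmannWeight, hl]

theorem boltzmann_smul (L : Set m) (b c : ℝ) (h : m → ℝ) :
    boltzmann L b (c • h) = boltzmann L (b * c) h := by
  ext l
  simp [boltzmann, boltzmannWeight, mul_assoc]

theorem boltzmann_neg (L : Set m) (b : ℝ) (h : m → ℝ) :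
    boltzmann L b (-h) = boltzmann L (-b) h := by
  simpa using boltzmann_smul L b (-1) h

theorem boltzmann_sub_const (L : Set m) (b : ℝ) (h : m → ℝ) (c : ℝ) :
    boltzmann L b (fun l => h l - c) = boltzmann L b h := by
  have hshift : boltzmannWeight L b (fun l => h l - c) =
      fun l => boltzmannWeight L b h l * Real.exp (b * c) := by
    ext l
    by_cases hl : l ∈ L
    · simp only [boltzmannWeight, Set.indicator_of_mem hl, ← Real.exp_add]
      ring_nf
    · simp [boltzmannWeight, hl]
  ext l
  simp only [boltzmann, hshift, ← Finset.sum_mul]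
  exact mul_div_mul_right _ _ (Real.exp_ne_zero _)

theorem continuous_boltzmann_univ [Nonempty m] (h : m → ℝ) :
    Continuous fun b => boltzmann Set.univ b h := by
  refine continuous_pi fun l => Continuous.div ?_ ?_
    fun b => (sum_boltzmannWeight_pos Set.univ_nonempty b h).ne'
  all_goals
    simp only [boltzmannWeight, Set.indicator_univ]
    fun_prop

end Boltzmann

section GroundLevel

variable {m : Type*}

/-- The set of levels of least energy. -/
def groundLevel (h : m → ℝ) : Set m := {l | ∀ i, h l ≤ h i}

theorem groundLevel_nonempty [Finite m] [Nonempty m] (h : m → ℝ) : (groundLevel h).Nonempty :=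
  Finite.exists_min h

theorem eq_of_mem_groundLevel {h : m → ℝ} {l l₀ : m} (hl : l ∈ groundLevel h)
    (hl₀ : l₀ ∈ groundLevel h) : h l = h l₀ :=
  le_antisymm (hl l₀) (hl₀ l)

theorem lt_of_notMem_groundLevel {h : m → ℝ} {l l₀ : m} (hl : l ∉ groundLevel h)
    (hl₀ : l₀ ∈ groundLevel h) : h l₀ < h l := by
  obtain ⟨i, hi⟩ := not_forall.1 hl
  exact (hl₀ i).trans_lt (not_le.1 hi)

variable [Fintype m]

theorem le_sum_mul_of_mem_groundLevel {p h : m → ℝ} (hp : ∀ l, 0 ≤ p l) (hp1 : ∑ l, p l = 1)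
    {l₀ : m} (hl₀ : l₀ ∈ groundLevel h) : h l₀ ≤ ∑ l, p l * h l :=
  calc h l₀ = ∑ l, p l * h l₀ := by rw [← Finset.sum_mul, hp1, one_mul]
    _ ≤ ∑ l, p l * h l :=
      Finset.sum_le_sum fun l _ => mul_le_mul_of_nonneg_left (hl₀ l) (hp l)

theorem sum_mul_eq_of_mem_groundLevel {p h : m → ℝ} (hp1 : ∑ l, p l = 1)
    (hp0 : ∀ l ∉ groundLevel h, p l = 0) {l₀ : m} (hl₀ : l₀ ∈ groundLevel h) :
    ∑ l, p l * h l = h l₀ := by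
  rw [← one_mul (h l₀), ← hp1, Finset.sum_mul]
  refine Finset.sum_congr rfl fun l _ => ?_
  by_cases hl : l ∈ groundLevel h
  · rw [eq_of_mem_groundLevel hl hl₀]
  · rw [hp0 l hl, zero_mul, zero_mul]

theorem eq_zero_of_sum_mul_eq_of_notMem_groundLevel {p h : m → ℝ} (hp : ∀ l, 0 ≤ p l)
    (hp1 : ∑ l, p l = 1) {l₀ : m} (hl₀ : l₀ ∈ groundLevel h) (he : ∑ l, p l * h l = h l₀) {l : m}
    (hl : l ∉ groundLevel h) : p l = 0 := by
  have hsum : ∑ l, p l * (h l - h l₀) = 0 := by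
    simp only [mul_sub, Finset.sum_sub_distrib, he, ← Finset.sum_mul, hp1, one_mul, sub_self]
  have hterm := (Finset.sum_eq_zero_iff_of_nonneg fun l _ =>
    mul_nonneg (hp l) (sub_nonneg.2 (hl₀ l))).1 hsum l (Finset.mem_univ l)
  exact (mul_eq_zero.1 hterm).resolve_right (sub_pos.2 (lt_of_notMem_groundLevel hl hl₀)).ne'

theorem tendsto_boltzmann_univ_atTop [Nonempty m] (h : m → ℝ) :
    Tendsto (fun b => boltzmann Set.univ b h) atTop (𝓝 (boltzmann (groundLevel h) 0 h)) := by
  obtain ⟨l₀, hl₀⟩ := groundLevel_nonempty h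
  have hweight : ∀ i, Tendsto (fun b => boltzmannWeight Set.univ b (fun l => h l - h l₀) i) atTop
      (𝓝 (boltzmannWeight (groundLevel h) 0 h i)) := fun i => by
    by_cases hi : i ∈ groundLevel h
    · simp [boltzmannWeight, hi, eq_of_mem_groundLevel hi hl₀]
    · have hgap : 0 < h i - h l₀ := sub_pos.2 (lt_of_notMem_groundLevel hi hl₀)
      simp only [boltzmannWeight, Set.indicator_univ, Set.indicator_of_notMem hi]
      exact Real.tendsto_exp_neg_atTop_nhds_zero.comp (tendsto_id.atTop_mul_const hgap)
  simp only [← boltzmann_sub_const Set.univ _ h (h l₀)]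
  exact tendsto_pi_nhds.2 fun l => (hweight l).div (tendsto_finsetSum _ fun i _ => hweight i)
    (sum_boltzmannWeight_pos ⟨l₀, hl₀⟩ 0 h).ne'

end GroundLevel

section Gibbs

variable {n : Type*} [Fintype n] [DecidableEq n] {W : Matrix n n ℂ}

theorem exp_smul_spectralMatrix (hW : W ∈ Matrix.unitaryGroup n ℂ) (c : ℝ) (h : n → ℝ) :
    NormedSpace.exp ((c : ℂ) • spectralMatrix W h) =
      spectralMatrix W fun l => Real.exp (c * h l) := by
  have hinv : W⁻¹ = Wᴴ := Matrix.inv_eq_right_inv (unitary_mul_conjTranspose hW)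
  have hunit : IsUnit W :=
    ⟨⟨W, Wᴴ, unitary_mul_conjTranspose hW, unitary_conjTranspose_mul hW⟩, rfl⟩
  have hsmul : (c : ℂ) • spectralMatrix W h =
      W * Matrix.diagonal (fun i => ((c * h i : ℝ) : ℂ)) * W⁻¹ := by
    rw [hinv, spectralMatrix, ← Matrix.smul_mul, ← Matrix.mul_smul, ← Matrix.diagonal_smul]
    congr 3
    ext i
    simp
  rw [hsmul, Matrix.exp_conj _ _ hunit, Matrix.exp_diagonal, hinv, spectralMatrix]
  congr 3
  ext i
  rw [Pi.coe_exp, ← Complex.exp_eq_exp_ℂ, Complex.ofReal_exp]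

theorem gibbs_spectralMatrix (hW : W ∈ Matrix.unitaryGroup n ℂ) (b : ℝ) (h : n → ℝ) :
    gibbs b (spectralMatrix W h) = spectralMatrix W (boltzmann Set.univ b h) := by
  have hexp := exp_smul_spectralMatrix hW (-b) h
  have htrace : (spectralMatrix W fun l => Real.exp (-b * h l)).trace =
      ((∑ l, Real.exp (-b * h l) : ℝ) : ℂ) := by
    rw [spectralMatrix, trace_conj_of_mem_unitaryGroup hW, Matrix.trace_diagonal,
      Complex.ofReal_sum]
  rw [gibbs, ← Complex.ofReal_neg, hexp, htrace, spectralMatrix, spectralMatrix, ← Matrix.smul_mul,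
    ← Matrix.mul_smul, ← Matrix.diagonal_smul]
  congr 3
  ext i
  simp [boltzmann, boltzmannWeight, div_eq_inv_mul]

theorem gibbs_neg (b : ℝ) (H : Matrix n n ℂ) : gibbs b (-H) = gibbs (-b) H := by
  simp [gibbs]

theorem isDensityMatrix_gibbs [Nonempty n] {H : Matrix n n ℂ} (hH : H.IsHermitian) (b : ℝ) :
    IsDensityMatrix (gibbs b H) := by
  obtain ⟨W, hW, h, rfl⟩ := exists_eq_spectralMatrix hH
  rw [gibbs_spectralMatrix hW]
  exact isDensityMatrix_spectralMatrix hW (boltzmann_nonneg _ b h)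
    (sum_boltzmann Set.univ_nonempty b h)

theorem gibbs_mem_microstates [Nonempty n] {H : Matrix n n ℂ} (hH : H.IsHermitian) (β : ℝ) :
    gibbs β H ∈ microstates (thermalEnergy β H) H :=
  ⟨isDensityMatrix_gibbs hH β, rfl⟩

theorem tendsto_gibbs_atTop [Nonempty n] (hW : W ∈ Matrix.unitaryGroup n ℂ) (h : n → ℝ) :
    Tendsto (fun b => gibbs b (spectralMatrix W h)) atTop
      (𝓝 (spectralMatrix W (boltzmann (groundLevel h) 0 h))) := by
  simp only [gibbs_spectralMatrix hW]
  exact ((continuous_spectralMatrix W).tendsto _).comp (tendsto_boltzmann_univ_atTop h)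

theorem continuous_gibbs [Nonempty n] {H : Matrix n n ℂ} (hH : H.IsHermitian) :
    Continuous fun b : ℝ => gibbs b H := by
  obtain ⟨W, hW, h, rfl⟩ := exists_eq_spectralMatrix hH
  simp only [gibbs_spectralMatrix hW]
  exact (continuous_spectralMatrix W).comp (continuous_boltzmann_univ h)

end Gibbs

section Canonical

variable {n : Type*} [Fintype n] [DecidableEq n] {W : Matrix n n ℂ} {h : n → ℝ} {l₀ : n}

theorem le_meanEnergy_spectralMatrix (hW : W ∈ Matrix.unitaryGroup n ℂ)
    (hl₀ : l₀ ∈ groundLevel h) {ρ : Matrix n n ℂ} (hρ : IsDensityMatrix ρ) :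
    h l₀ ≤ meanEnergy (spectralMatrix W h) ρ := by
  rw [meanEnergy_spectralMatrix]
  exact le_sum_mul_of_mem_groundLevel (hρ.population_nonneg hW) (hρ.sum_population hW) hl₀

theorem meanEnergy_boltzmann_groundLevel (hW : W ∈ Matrix.unitaryGroup n ℂ)
    (hl₀ : l₀ ∈ groundLevel h) (b : ℝ) :
    meanEnergy (spectralMatrix W h) (spectralMatrix W (boltzmann (groundLevel h) b h)) = h l₀ := by
  rw [meanEnergy_spectralMatrix, population_spectralMatrix hW]
  exact sum_mul_eq_of_mem_groundLevel (sum_boltzmann ⟨l₀, hl₀⟩ b h)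
    (fun l => boltzmann_of_notMem b h) hl₀

theorem tendsto_meanEnergy_gibbs_atTop (hW : W ∈ Matrix.unitaryGroup n ℂ)
    (hl₀ : l₀ ∈ groundLevel h) :
    Tendsto (fun b => meanEnergy (spectralMatrix W h) (gibbs b (spectralMatrix W h))) atTop
      (𝓝 (h l₀)) := by
  have : Nonempty n := ⟨l₀⟩
  rw [← meanEnergy_boltzmann_groundLevel hW hl₀ 0]
  exact ((continuous_meanEnergy _).tendsto _).comp (tendsto_gibbs_atTop hW h)

theorem tendsto_meanEnergy_gibbs_atBot (hW : W ∈ Matrix.unitaryGroup n ℂ)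
    (hl₀ : l₀ ∈ groundLevel (-h)) :
    Tendsto (fun b => meanEnergy (spectralMatrix W h) (gibbs b (spectralMatrix W h))) atBot
      (𝓝 (h l₀)) := by
  simpa [Function.comp_def, spectralMatrix_neg, gibbs_neg, meanEnergy_neg] using
    (tendsto_meanEnergy_gibbs_atTop hW hl₀).neg.comp tendsto_neg_atBot_atTop

namespace IsCanonicalEnsemble

variable {e : ℝ} {H γ : Matrix n n ℂ}

theorem neg (hγ : IsCanonicalEnsemble e H γ) : IsCanonicalEnsemble (-e) (-H) γ := by
  obtain ⟨henergy, hgibbs⟩ := hγ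
  refine ⟨by rw [meanEnergy_neg, henergy], ?_⟩
  simp only [gibbs_neg]
  rcases hgibbs with ⟨b, rfl⟩ | htop | hbot
  · exact Or.inl ⟨-b, by rw [neg_neg]⟩
  · exact Or.inr (Or.inr (htop.comp tendsto_neg_atBot_atTop))
  · exact Or.inr (Or.inl (hbot.comp tendsto_neg_atTop_atBot))

theorem isDensityMatrix [Nonempty n] (hH : H.IsHermitian) (hγ : IsCanonicalEnsemble e H γ) :
    IsDensityMatrix γ := by
  rcases hγ.2 with ⟨b, rfl⟩ | hlim | hlim
  · exact isDensityMatrix_gibbs hH b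
  all_goals
    exact isClosed_isDensityMatrix.mem_of_tendsto hlim
      (Eventually.of_forall fun b => isDensityMatrix_gibbs hH b)

end IsCanonicalEnsemble

theorem exists_isCanonicalEnsemble_of_mem_groundLevel (hW : W ∈ Matrix.unitaryGroup n ℂ)
    (hl₀ : l₀ ∈ groundLevel h) : ∃ γ, IsCanonicalEnsemble (h l₀) (spectralMatrix W h) γ :=
  have : Nonempty n := ⟨l₀⟩
  ⟨_, meanEnergy_boltzmann_groundLevel hW hl₀ 0, Or.inr (Or.inl (tendsto_gibbs_atTop hW h))⟩

theorem exists_isCanonicalEnsemble {H : Matrix n n ℂ} (hH : H.IsHermitian) {e : ℝ}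
    (he : (microstates e H).Nonempty) : ∃ γ, IsCanonicalEnsemble e H γ := by
  obtain ⟨ρ, hρ, rfl⟩ := he
  have : Nonempty n := hρ.nonempty
  obtain ⟨W, hW, h, rfl⟩ := exists_eq_spectralMatrix hH
  obtain ⟨l₀, hl₀⟩ := groundLevel_nonempty h
  obtain ⟨l₁, hl₁⟩ := groundLevel_nonempty (-h)
  set e := meanEnergy (spectralMatrix W h) ρ
  have hmin : h l₀ ≤ e := le_meanEnergy_spectralMatrix hW hl₀ hρ
  have hmax : e ≤ h l₁ := by
    simpa [spectralMatrix_neg, meanEnergy_neg] using le_meanEnergy_spectralMatrix hW hl₁ hρ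
  rcases hmin.eq_or_lt with hmin | hmin
  · exact hmin ▸ exists_isCanonicalEnsemble_of_mem_groundLevel hW hl₀
  rcases hmax.eq_or_lt with hmax | hmax
  · obtain ⟨γ, hγ⟩ := exists_isCanonicalEnsemble_of_mem_groundLevel hW hl₁
    exact ⟨γ, by simpa [spectralMatrix_neg, ← hmax] using hγ.neg⟩
  obtain ⟨b, hb⟩ := mem_range_of_exists_le_of_exists_ge
    ((continuous_meanEnergy _).comp (continuous_gibbs hH))
    ((tendsto_meanEnergy_gibbs_atTop hW hl₀).eventually_le_const hmin).exists
    ((tendsto_meanEnergy_gibbs_atBot hW hl₁).eventually_const_le hmax).exists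
  exact ⟨_, hb, Or.inl ⟨b, rfl⟩⟩

theorem exists_eq_boltzmann_of_tendsto_atTop [Nonempty n] (hW : W ∈ Matrix.unitaryGroup n ℂ)
    {e : ℝ} {γ : Matrix n n ℂ} (henergy : meanEnergy (spectralMatrix W h) γ = e)
    (hlim : Tendsto (fun b : ℝ => gibbs b (spectralMatrix W h)) atTop (𝓝 γ)) :
    γ = spectralMatrix W (boltzmann (groundLevel h) 0 h) ∧
      ∀ ρ ∈ microstates e (spectralMatrix W h), ∀ l ∉ groundLevel h, population W ρ l = 0 := by
  obtain rfl := tendsto_nhds_unique hlim (tendsto_gibbs_atTop hW h)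
  refine ⟨rfl, fun ρ ⟨hρ, hρe⟩ l hl => ?_⟩
  obtain ⟨l₀, hl₀⟩ := groundLevel_nonempty h
  refine eq_zero_of_sum_mul_eq_of_notMem_groundLevel (hρ.population_nonneg hW)
    (hρ.sum_population hW) hl₀ ?_ hl
  rw [← meanEnergy_spectralMatrix, hρe, ← henergy, meanEnergy_boltzmann_groundLevel hW hl₀]

theorem IsCanonicalEnsemble.exists_eq_boltzmann [Nonempty n] (hW : W ∈ Matrix.unitaryGroup n ℂ)
    {e : ℝ} {γ : Matrix n n ℂ} (hγ : IsCanonicalEnsemble e (spectralMatrix W h) γ) :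
    ∃ (b : ℝ) (L : Set n), L.Nonempty ∧ γ = spectralMatrix W (boltzmann L b h) ∧
      ∀ ρ ∈ microstates e (spectralMatrix W h), ∀ l ∉ L, population W ρ l = 0 := by
  rcases hγ.2 with ⟨b, rfl⟩ | htop | hbot
  · exact ⟨b, Set.univ, Set.univ_nonempty, gibbs_spectralMatrix hW b h,
      fun ρ _ l hl => (hl trivial).elim⟩
  · exact ⟨0, groundLevel h, groundLevel_nonempty h,
      exists_eq_boltzmann_of_tendsto_atTop hW hγ.1 htop⟩
  · have htop : Tendsto (fun b : ℝ => gibbs b (spectralMatrix W (-h))) atTop (𝓝 γ) := by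
      simpa [Function.comp_def, spectralMatrix_neg, gibbs_neg] using
        hbot.comp tendsto_neg_atTop_atBot
    have henergy : meanEnergy (spectralMatrix W (-h)) γ = -e := by
      rw [spectralMatrix_neg, meanEnergy_neg, hγ.1]
    have hground := exists_eq_boltzmann_of_tendsto_atTop hW henergy htop
    rw [boltzmann_neg, spectralMatrix_neg, microstates_neg] at hground
    exact ⟨-0, groundLevel (-h), groundLevel_nonempty _, hground⟩

end Canonical

section BoltzmannProduct

theorem boltzmann_fst_preimage {m z : Type*} [Fintype m] [Fintype z] (L : Set m) (b : ℝ)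
    (h : m → ℝ) (k : z → ℝ) :
    boltzmann (Prod.fst ⁻¹' L) b (fun x : m × z => h x.1 + k x.2) =
      fun x => boltzmann L b h x.1 * boltzmann Set.univ b k x.2 := by
  have hweight : ∀ x : m × z, boltzmannWeight (Prod.fst ⁻¹' L) b (fun x => h x.1 + k x.2) x =
      boltzmannWeight L b h x.1 * boltzmannWeight Set.univ b k x.2 := fun x => by
    by_cases hx : x.1 ∈ L
    · simp [boltzmannWeight, hx, mul_add, Real.exp_add, mul_comm]
    · simp [boltzmannWeight, hx]
  ext x
  simp only [boltzmann, hweight, Fintype.sum_prod_type, ← Finset.mul_sum, ← Finset.sum_mul,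
    div_mul_div_comm]

theorem boltzmann_univ_pi {ι : Type*} [Fintype ι] [DecidableEq ι] {X : ι → Type*}
    [∀ i, Fintype (X i)] (b : ℝ) (k : ∀ i, X i → ℝ) :
    boltzmann Set.univ b (fun x : ∀ i, X i => ∑ i, k i (x i)) =
      fun x => ∏ i, boltzmann Set.univ b (k i) (x i) := by
  ext x
  simp only [boltzmann, boltzmannWeight, Set.indicator_univ, Finset.prod_div_distrib,
    Finset.mul_sum, ← Finset.sum_neg_distrib, Real.exp_sum]
  rw [Finset.prod_univ_sum, Fintype.piFinset_univ]

end BoltzmannProduct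

section PartialTrace

variable {m z : Type*} [Fintype z]

theorem partialTrace_kronecker (A : Matrix m m ℂ) (B : Matrix z z ℂ) :
    partialTrace (A ⊗ₖ B) = B.trace • A := by
  ext i j
  simp [partialTrace, Matrix.trace, ← Finset.mul_sum, mul_comm]

theorem partialTrace_submatrix_assoc {n x y : Type*} [Fintype x] [Fintype y]
    (e : z ≃ x × y) (X : Matrix ((n × x) × y) ((n × x) × y) ℂ) :
    partialTrace (X.submatrix (((Equiv.refl n).prodCongr e).trans (Equiv.prodAssoc n x y).symm)
      (((Equiv.refl n).prodCongr e).trans (Equiv.prodAssoc n x y).symm)) =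
      partialTrace (partialTrace X) := by
  ext i j
  simp only [partialTrace, Matrix.of_apply, Matrix.submatrix_apply]
  rw [← Fintype.sum_prod_type' (f := fun a b => X ((i, a), b) ((j, a), b)), ← e.sum_comp]
  rfl

theorem continuous_partialTrace :
    Continuous (partialTrace : Matrix (m × z) (m × z) ℂ → Matrix m m ℂ) := by
  unfold partialTrace
  fun_prop

variable [Fintype m] [DecidableEq z]

theorem partialTrace_conj_kronecker_one (T : Matrix m m ℂ) (X : Matrix (m × z) (m × z) ℂ) :
    partialTrace ((T ⊗ₖ (1 : Matrix z z ℂ)) * X * (T ⊗ₖ (1 : Matrix z z ℂ))ᴴ) =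
      T * partialTrace X * Tᴴ := by
  ext i j
  simp only [partialTrace, Matrix.of_apply, Matrix.mul_apply, Matrix.conjTranspose_apply,
    Matrix.kroneckerMap_apply, Fintype.sum_prod_type, Matrix.one_apply, mul_ite, mul_one, mul_zero,
    ite_mul, zero_mul, apply_ite star, star_zero, Finset.sum_ite_eq, Finset.mem_univ, if_true,
    Finset.sum_mul, Finset.mul_sum]
  rw [Finset.sum_comm]
  refine Finset.sum_congr rfl fun _ _ => ?_
  rw [Finset.sum_comm]

theorem meanEnergy_kronecker_one (A : Matrix m m ℂ) (X : Matrix (m × z) (m × z) ℂ) :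
    meanEnergy (A ⊗ₖ (1 : Matrix z z ℂ)) X = meanEnergy A (partialTrace X) := by
  simp only [meanEnergy, Matrix.trace, Matrix.diag_apply, partialTrace, Matrix.of_apply,
    Matrix.mul_apply, Matrix.kroneckerMap_apply, Fintype.sum_prod_type, Matrix.one_apply, mul_ite,
    mul_one, mul_zero, Finset.sum_ite_eq', Finset.mem_univ, if_true, Finset.sum_mul]
  congr 1
  refine Finset.sum_congr rfl fun _ _ => ?_
  rw [Finset.sum_comm]

theorem kronecker_one_mem_unitaryGroup [DecidableEq m] {U : Matrix m m ℂ}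
    (hU : U ∈ Matrix.unitaryGroup m ℂ) :
    U ⊗ₖ (1 : Matrix z z ℂ) ∈ Matrix.unitaryGroup (m × z) ℂ :=
  Matrix.kronecker_mem_unitary hU (one_mem _)

theorem meanEnergy_one_kronecker_conj [DecidableEq m] {U : Matrix m m ℂ}
    (hU : U ∈ Matrix.unitaryGroup m ℂ) (D : Matrix z z ℂ) (X : Matrix (m × z) (m × z) ℂ) :
    meanEnergy ((1 : Matrix m m ℂ) ⊗ₖ D)
      ((U ⊗ₖ (1 : Matrix z z ℂ)) * X * (U ⊗ₖ (1 : Matrix z z ℂ))ᴴ) =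
      meanEnergy ((1 : Matrix m m ℂ) ⊗ₖ D) X := by
  rw [meanEnergy, Matrix.mul_assoc, Matrix.mul_assoc, Matrix.trace_mul_comm, Matrix.mul_assoc,
    Matrix.conjTranspose_kronecker, Matrix.conjTranspose_one, ← Matrix.mul_kronecker_mul,
    ← Matrix.mul_kronecker_mul, Matrix.mul_one, unitary_conjTranspose_mul hU, Matrix.mul_one,
    Matrix.one_mul, meanEnergy]

end PartialTrace

section TensorProd

variable {ι : Type*} [Fintype ι] {X : ι → Type*}

theorem conjTranspose_tensorProd (A : ∀ i, Matrix (X i) (X i) ℂ) :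
    (tensorProd A)ᴴ = tensorProd fun i => (A i)ᴴ := by
  ext x y
  simp [tensorProd]

theorem tensorProd_diagonal [∀ i, DecidableEq (X i)] (d : ∀ i, X i → ℂ) :
    tensorProd (fun i => Matrix.diagonal (d i)) = Matrix.diagonal fun x => ∏ i, d i (x i) := by
  ext x y
  by_cases hxy : x = y
  · subst hxy
    simp [tensorProd]
  · obtain ⟨i, hi⟩ := Function.ne_iff.1 hxy
    rw [Matrix.diagonal_apply_ne _ hxy, tensorProd, Matrix.of_apply]
    exact Finset.prod_eq_zero (Finset.mem_univ i) (Matrix.diagonal_apply_ne _ hi)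

theorem tensorProd_one [∀ i, DecidableEq (X i)] :
    tensorProd (fun i => (1 : Matrix (X i) (X i) ℂ)) = 1 := by
  simp only [← Matrix.diagonal_one, tensorProd_diagonal, Finset.prod_const_one]

theorem tensorProd_sum {κ : Type*} [Fintype κ] {Y : ι ⊕ κ → Type*}
    (A : ∀ i, Matrix (Y i) (Y i) ℂ) :
    tensorProd A = (tensorProd (fun i => A (Sum.inl i)) ⊗ₖ
      tensorProd fun i => A (Sum.inr i)).submatrix
      (Equiv.sumPiEquivProdPi Y) (Equiv.sumPiEquivProdPi Y) := by
  ext x y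
  simp [tensorProd, Fintype.prod_sum_type]

variable [DecidableEq ι] [∀ i, Fintype (X i)]

theorem tensorProd_mul (A B : ∀ i, Matrix (X i) (X i) ℂ) :
    tensorProd A * tensorProd B = tensorProd fun i => A i * B i := by
  ext x y
  simp only [tensorProd, Matrix.mul_apply, Matrix.of_apply, ← Finset.prod_mul_distrib]
  rw [Finset.prod_univ_sum, Fintype.piFinset_univ]

theorem trace_tensorProd (A : ∀ i, Matrix (X i) (X i) ℂ) :
    (tensorProd A).trace = ∏ i, (A i).trace := by
  simp only [tensorProd, Matrix.trace, Matrix.diag_apply, Matrix.of_apply]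
  rw [Finset.prod_univ_sum, Fintype.piFinset_univ]

open scoped MatrixOrder Matrix.Norms.L2Operator in
theorem isDensityMatrix_tensorProd {σ : ∀ i, Matrix (X i) (X i) ℂ}
    (hσ : ∀ i, IsDensityMatrix (σ i)) : IsDensityMatrix (tensorProd σ) := by
  classical
  choose B hB using fun i => CStarAlgebra.nonneg_iff_eq_star_mul_self.1 (hσ i).1.nonneg
  have hfactor : tensorProd σ = (tensorProd B)ᴴ * tensorProd B := by
    rw [conjTranspose_tensorProd, tensorProd_mul]
    exact congrArg _ (funext hB)
  refine ⟨hfactor ▸ Matrix.posSemidef_conjTranspose_mul_self _, ?_⟩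
  rw [trace_tensorProd]
  exact Finset.prod_eq_one fun i _ => (hσ i).2

variable [∀ i, DecidableEq (X i)]

theorem tensorProd_mem_unitaryGroup {W : ∀ i, Matrix (X i) (X i) ℂ}
    (hW : ∀ i, W i ∈ Matrix.unitaryGroup (X i) ℂ) :
    tensorProd W ∈ Matrix.unitaryGroup (∀ i, X i) ℂ := by
  rw [Matrix.mem_unitaryGroup_iff, Matrix.star_eq_conjTranspose, conjTranspose_tensorProd,
    tensorProd_mul]
  simp only [fun i => unitary_mul_conjTranspose (hW i), tensorProd_one]

theorem tensorProd_spectralMatrix (W : ∀ i, Matrix (X i) (X i) ℂ) (p : ∀ i, X i → ℝ) :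
    tensorProd (fun i => spectralMatrix (W i) (p i)) =
      spectralMatrix (tensorProd W) fun x => ∏ i, p i (x i) := by
  simp only [spectralMatrix, ← tensorProd_mul, ← conjTranspose_tensorProd, tensorProd_diagonal,
    Complex.ofReal_prod]

end TensorProd

section Kronecker

variable {m n : Type*} [Fintype m] [Fintype n]

theorem IsDensityMatrix.kronecker {A : Matrix m m ℂ} {B : Matrix n n ℂ} (hA : IsDensityMatrix A)
    (hB : IsDensityMatrix B) : IsDensityMatrix (A ⊗ₖ B) :=
  ⟨hA.1.kronecker hB.1, by rw [Matrix.trace_kronecker, hA.2, hB.2, one_mul]⟩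

theorem kronecker_spectralMatrix [DecidableEq m] [DecidableEq n] (V : Matrix m m ℂ)
    (W : Matrix n n ℂ) (g : m → ℝ) (p : n → ℝ) :
    spectralMatrix V g ⊗ₖ spectralMatrix W p =
      spectralMatrix (V ⊗ₖ W) fun x => g x.1 * p x.2 := by
  simp only [spectralMatrix, Matrix.conjTranspose_kronecker, Complex.ofReal_mul,
    Matrix.mul_kronecker_mul]
  rw [Matrix.diagonal_kronecker_diagonal]

theorem population_kronecker {V ρ : Matrix m m ℂ} [DecidableEq m]
    (hV : V ∈ Matrix.unitaryGroup m ℂ) (hρ : IsDensityMatrix ρ) (W τ : Matrix n n ℂ) (x : m × n) :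
    population (V ⊗ₖ W) (ρ ⊗ₖ τ) x = population V ρ x.1 * population W τ x.2 := by
  have hdiag := (hρ.conj (conjTranspose_mem_unitaryGroup hV)).ofReal_re_diag x.1
  rw [Matrix.conjTranspose_conjTranspose] at hdiag
  rw [population, Matrix.conjTranspose_kronecker, ← Matrix.mul_kronecker_mul,
    ← Matrix.mul_kronecker_mul, Matrix.kroneckerMap_apply, ← hdiag, Complex.re_ofReal_mul,
    population, population]

end Kronecker

section LocalOperator

variable {ι : Type*} [Fintype ι] [DecidableEq ι] {X : ι → Type*} [∀ i, DecidableEq (X i)]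

/-- The operator `1 ⊗ ⋯ ⊗ A ⊗ ⋯ ⊗ 1` with `A` acting on the `i`-th tensor factor, the summand of
`Environment.totalHam`. -/
noncomputable def localOperator (i : ι) (A : Matrix (X i) (X i) ℂ) :
    Matrix (∀ i, X i) (∀ i, X i) ℂ :=
  tensorProd (Function.update (fun j => (1 : Matrix (X j) (X j) ℂ)) i A)

theorem localOperator_diagonal (i : ι) (d : X i → ℂ) :
    localOperator i (Matrix.diagonal d) = Matrix.diagonal fun x : ∀ i, X i => d (x i) := by
  have hfactor : Function.update (fun j => (1 : Matrix (X j) (X j) ℂ)) i (Matrix.diagonal d) =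
      fun j => Matrix.diagonal (Function.update (fun j (_ : X j) => (1 : ℂ)) i d j) := by
    ext1 j
    rw [Function.apply_update fun j => Matrix.diagonal (n := X j) (α := ℂ)]
    simp only [Matrix.diagonal_one]
  rw [localOperator, hfactor, tensorProd_diagonal]
  congr 1
  ext x
  rw [Finset.prod_eq_single i (fun j _ hj => by simp [hj]) (by simp), Function.update_self]

theorem sum_localOperator_diagonal (d : ∀ i, X i → ℂ) :
    ∑ i, localOperator i (Matrix.diagonal (d i)) =
      Matrix.diagonal fun x : ∀ i, X i => ∑ i, d i (x i) := by
  simp only [localOperator_diagonal]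
  ext x y
  rw [Matrix.sum_apply]
  by_cases hxy : x = y
  · simp only [hxy, Matrix.diagonal_apply_eq]
  · simp only [Matrix.diagonal_apply_ne _ hxy, Finset.sum_const_zero]

theorem localOperator_inl {κ : Type*} [Fintype κ] [DecidableEq κ] {Y : ι ⊕ κ → Type*}
    [∀ i, DecidableEq (Y i)] (i : ι) (A : Matrix (Y (Sum.inl i)) (Y (Sum.inl i)) ℂ) :
    localOperator (Sum.inl i) A =
      (localOperator (X := fun j => Y (Sum.inl j)) i A ⊗ₖ
        (1 : Matrix (∀ j, Y (Sum.inr j)) (∀ j, Y (Sum.inr j)) ℂ)).submatrix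
      (Equiv.sumPiEquivProdPi Y) (Equiv.sumPiEquivProdPi Y) := by
  rw [localOperator, tensorProd_sum, ← tensorProd_one, localOperator,
    Function.update_comp_eq_of_injective' (fun j => (1 : Matrix (Y j) (Y j) ℂ)) Sum.inl_injective,
    Function.update_comp_eq_of_forall_ne' (fun j => (1 : Matrix (Y j) (Y j) ℂ)) A
      fun _ => Sum.inr_ne_inl]

theorem localOperator_inr {κ : Type*} [Fintype κ] [DecidableEq κ] {Y : ι ⊕ κ → Type*}
    [∀ i, DecidableEq (Y i)] (i : κ) (A : Matrix (Y (Sum.inr i)) (Y (Sum.inr i)) ℂ) :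
    localOperator (Sum.inr i) A =
      ((1 : Matrix (∀ j, Y (Sum.inl j)) (∀ j, Y (Sum.inl j)) ℂ) ⊗ₖ
        localOperator (X := fun j => Y (Sum.inr j)) i A).submatrix
      (Equiv.sumPiEquivProdPi Y) (Equiv.sumPiEquivProdPi Y) := by
  rw [localOperator, tensorProd_sum, ← tensorProd_one, localOperator,
    Function.update_comp_eq_of_injective' (fun j => (1 : Matrix (Y j) (Y j) ℂ)) Sum.inr_injective,
    Function.update_comp_eq_of_forall_ne' (fun j => (1 : Matrix (Y j) (Y j) ℂ)) A
      fun _ => Sum.inl_ne_inr]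

theorem sum_localOperator_sum {κ : Type*} [Fintype κ] [DecidableEq κ] {Y : ι ⊕ κ → Type*}
    [∀ i, DecidableEq (Y i)] (A : ∀ i, Matrix (Y i) (Y i) ℂ) :
    ∑ i, localOperator i (A i) =
      ((∑ i, localOperator (X := fun j => Y (Sum.inl j)) i (A (Sum.inl i))) ⊗ₖ
        (1 : Matrix (∀ j, Y (Sum.inr j)) (∀ j, Y (Sum.inr j)) ℂ) +
      (1 : Matrix (∀ j, Y (Sum.inl j)) (∀ j, Y (Sum.inl j)) ℂ) ⊗ₖ
        ∑ i, localOperator (X := fun j => Y (Sum.inr j)) i (A (Sum.inr i))).submatrix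
      (Equiv.sumPiEquivProdPi Y) (Equiv.sumPiEquivProdPi Y) := by
  rw [Fintype.sum_sum_type]
  simp only [localOperator_inl, localOperator_inr]
  ext x y
  simp only [Matrix.submatrix_apply, Matrix.add_apply, Matrix.sum_apply, Matrix.kroneckerMap_apply,
    Finset.sum_mul, Finset.mul_sum]

variable [∀ i, Fintype (X i)]

theorem tensorProd_conj_localOperator {W : ∀ i, Matrix (X i) (X i) ℂ}
    (hW : ∀ i, W i ∈ Matrix.unitaryGroup (X i) ℂ) (i : ι) (A : Matrix (X i) (X i) ℂ) :
    tensorProd W * localOperator i A * (tensorProd W)ᴴ =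
      localOperator i (W i * A * (W i)ᴴ) := by
  rw [localOperator, conjTranspose_tensorProd, tensorProd_mul, tensorProd_mul, localOperator]
  congr 1
  ext1 j
  rw [Function.apply_update fun j (M : Matrix (X j) (X j) ℂ) => W j * M * (W j)ᴴ]
  simp only [Matrix.mul_one, fun j => unitary_mul_conjTranspose (hW j)]

theorem sum_localOperator_spectralMatrix {W : ∀ i, Matrix (X i) (X i) ℂ}
    (hW : ∀ i, W i ∈ Matrix.unitaryGroup (X i) ℂ) (k : ∀ i, X i → ℝ) :
    ∑ i, localOperator i (spectralMatrix (W i) (k i)) =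
      spectralMatrix (tensorProd W) fun x => ∑ i, k i (x i) := by
  simp only [spectralMatrix, ← tensorProd_conj_localOperator hW]
  rw [← Finset.sum_mul, ← Finset.mul_sum, sum_localOperator_diagonal]
  simp only [Complex.ofReal_sum]

theorem meanEnergy_localOperator {σ : ∀ i, Matrix (X i) (X i) ℂ} (hσ : ∀ i, (σ i).trace = 1)
    (i : ι) (A : Matrix (X i) (X i) ℂ) :
    meanEnergy (localOperator i A) (tensorProd σ) = meanEnergy A (σ i) := by
  rw [meanEnergy, localOperator, tensorProd_mul, trace_tensorProd, Finset.prod_eq_single i,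
    Function.update_self, meanEnergy]
  · intro j _ hj
    rw [Function.update_of_ne hj, Matrix.mul_one, hσ]
  · simp

end LocalOperator

namespace Environment

variable {n : Type*} (E F : Environment)

/-- The thermal macrostate of an environment: every system has the mean energy of its Gibbs state
at inverse temperature `β`. -/
def IsThermal (β : ℝ) (σ : ∀ i, Matrix (E.X i) (E.X i) ℂ) : Prop :=
  ∀ i, σ i ∈ microstates (thermalEnergy β (E.ham i)) (E.ham i)

/-- The environment consisting of the systems of `E` and those of `F`. -/
protected def sum : Environment where
  ι := E.ι ⊕ F.ι
  X := Sum.elim E.X F.X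
  fintypeBasis := Sum.rec E.fintypeBasis F.fintypeBasis
  decEqBasis := Sum.rec E.decEqBasis F.decEqBasis
  nonemptyBasis := Sum.rec E.nonemptyBasis F.nonemptyBasis
  ham := Sum.rec E.ham F.ham
  isHermitian_ham := Sum.rec E.isHermitian_ham F.isHermitian_ham

/-- The splitting of the basis labels of `E.sum F`. -/
def basisSum : (E.sum F).Basis ≃ E.Basis × F.Basis :=
  Equiv.sumPiEquivProdPi (Sum.elim E.X F.X)

/-- The splitting of the basis labels of a system with the environment `E.sum F`. -/
def jointBasisSum (n : Type*) : n × (E.sum F).Basis ≃ (n × E.Basis) × F.Basis :=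
  ((Equiv.refl n).prodCongr (E.basisSum F)).trans (Equiv.prodAssoc _ _ _).symm

variable {E F}

theorem kronecker_tensorProd_sum (ρ : Matrix n n ℂ)
    (σ : ∀ i, Matrix ((E.sum F).X i) ((E.sum F).X i) ℂ) :
    ρ ⊗ₖ tensorProd σ = ((ρ ⊗ₖ tensorProd (X := E.X) fun i => σ (Sum.inl i)) ⊗ₖ
      tensorProd (X := F.X) fun i => σ (Sum.inr i)).submatrix
        (E.jointBasisSum F n) (E.jointBasisSum F n) := by
  have hsplit : tensorProd σ = (tensorProd (X := E.X) (fun i => σ (Sum.inl i)) ⊗ₖ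
      tensorProd (X := F.X) fun i => σ (Sum.inr i)).submatrix (E.basisSum F) (E.basisSum F) :=
    tensorProd_sum (Y := Sum.elim E.X F.X) σ
  rw [hsplit]
  ext x y
  exact (mul_assoc _ _ _).symm

theorem totalHam_sum :
    (E.sum F).totalHam = (F.jointHam E.totalHam).submatrix (E.basisSum F) (E.basisSum F) :=
  @sum_localOperator_sum _ _ _ _ _ _ (Sum.elim E.X F.X) (E.sum F).decEqBasis (E.sum F).ham

variable [DecidableEq n]

theorem jointHam_sum (H : Matrix n n ℂ) :
    (E.sum F).jointHam H = (F.jointHam (E.jointHam H)).submatrix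
      (E.jointBasisSum F n) (E.jointBasisSum F n) := by
  have hone : (1 : Matrix (E.sum F).Basis (E.sum F).Basis ℂ) =
      ((1 : Matrix E.Basis E.Basis ℂ) ⊗ₖ (1 : Matrix F.Basis F.Basis ℂ)).submatrix
        (E.basisSum F) (E.basisSum F) := by
    rw [Matrix.one_kronecker_one, Matrix.submatrix_one_equiv]
  rw [jointHam, totalHam_sum, hone, jointHam, jointHam, jointHam, Matrix.add_kronecker,
    ← Matrix.one_kronecker_one]
  ext x y
  simp only [Matrix.add_apply, Matrix.submatrix_apply, Matrix.kroneckerMap_apply,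
    jointBasisSum, Equiv.trans_apply, Equiv.prodCongr_apply, Prod.map_fst,
    Prod.map_snd, Equiv.prodAssoc_symm_apply, Equiv.refl_apply]
  ring

variable [Fintype n]

theorem meanEnergy_jointHam (H : Matrix n n ℂ) {ρ : Matrix n n ℂ} (hρ : ρ.trace = 1)
    {σ : ∀ i, Matrix (E.X i) (E.X i) ℂ} (hσ : ∀ i, (σ i).trace = 1) :
    meanEnergy (E.jointHam H) (ρ ⊗ₖ tensorProd σ) =
      meanEnergy H ρ + ∑ i, meanEnergy (E.ham i) (σ i) := by
  have hE : (tensorProd σ).trace = 1 := by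
    rw [trace_tensorProd]
    exact Finset.prod_eq_one fun i _ => hσ i
  have htotal : meanEnergy E.totalHam (tensorProd σ) = ∑ i, meanEnergy (E.ham i) (σ i) := by
    simp only [← meanEnergy_localOperator hσ]
    rw [meanEnergy, totalHam, Finset.mul_sum, Matrix.trace_sum, Complex.re_sum]
    rfl
  rw [jointHam, meanEnergy_add, meanEnergy_kronecker_one, partialTrace_kronecker, hE, one_smul,
    ← htotal]
  congr 1
  rw [meanEnergy, ← Matrix.mul_kronecker_mul, Matrix.trace_kronecker, Matrix.mul_one, hρ, one_mul,
    meanEnergy]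

theorem IsThermal.meanEnergy_jointHam {β e : ℝ} {H ρ : Matrix n n ℂ} (hρ : ρ ∈ microstates e H)
    {σ : ∀ i, Matrix (E.X i) (E.X i) ℂ} (hσ : E.IsThermal β σ) :
    meanEnergy (E.jointHam H) (ρ ⊗ₖ tensorProd σ) = e + ∑ i, thermalEnergy β (E.ham i) := by
  rw [Environment.meanEnergy_jointHam H hρ.1.2 fun i => (hσ i).1.2, hρ.2]
  exact congrArg _ (Finset.sum_congr rfl fun i _ => (hσ i).2)

theorem isThermal_gibbs (β : ℝ) : E.IsThermal β fun i => gibbs β (E.ham i) :=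
  fun i => gibbs_mem_microstates (E.isHermitian_ham i) β

theorem jointHam_eq_spectralMatrix {V : Matrix n n ℂ} (hV : V ∈ Matrix.unitaryGroup n ℂ)
    (h : n → ℝ) {W : ∀ i, Matrix (E.X i) (E.X i) ℂ}
    (hW : ∀ i, W i ∈ Matrix.unitaryGroup (E.X i) ℂ) {k : ∀ i, E.X i → ℝ}
    (hk : ∀ i, E.ham i = spectralMatrix (W i) (k i)) :
    E.jointHam (spectralMatrix V h) =
      spectralMatrix (V ⊗ₖ tensorProd W) fun x => h x.1 + ∑ i, k i (x.2 i) := by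
  have htotal : E.totalHam = spectralMatrix (tensorProd W) fun x => ∑ i, k i (x i) := by
    rw [← sum_localOperator_spectralMatrix hW]
    simp only [← hk]
    rfl
  rw [jointHam, htotal, ← spectralMatrix_const_one (tensorProd_mem_unitaryGroup hW),
    ← spectralMatrix_const_one hV, kronecker_spectralMatrix, kronecker_spectralMatrix,
    spectralMatrix_add]
  simp only [mul_one, one_mul]
  rfl

end Environment

section Qubits

variable {N : Type} [Fintype N]

/-- The energy levels of a qubit with excitation energy `w`. -/
def qubitLevel (w : ℝ) (b : Bool) : ℝ := if b then w else 0

/-- The energy of the configuration `z` of qubits with excitation energies `w`. -/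
def qubitEnergy (w : N → ℝ) (z : N → Bool) : ℝ := ∑ i, qubitLevel (w i) (z i)

theorem qubitEnergy_sumElim {N' : Type} [Fintype N'] (w : N → ℝ) (w' : N' → ℝ)
    (z : N ⊕ N' → Bool) :
    qubitEnergy (Sum.elim w w') z = qubitEnergy w (z ∘ Sum.inl) + qubitEnergy w' (z ∘ Sum.inr) := by
  simp [qubitEnergy]

variable [DecidableEq N]

/-- The thermal distribution of the configurations of qubits with excitation energies `w`. -/
noncomputable def qubitDistribution (β : ℝ) (w : N → ℝ) : (N → Bool) → ℝ :=
  boltzmann Set.univ β (qubitEnergy w)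

theorem qubitDistribution_eq_prod (β : ℝ) (w : N → ℝ) :
    qubitDistribution β w = fun z => ∏ i, boltzmann Set.univ β (qubitLevel (w i)) (z i) :=
  boltzmann_univ_pi β fun i => qubitLevel (w i)

theorem sum_qubitDistribution (β : ℝ) (w : N → ℝ) : ∑ z, qubitDistribution β w z = 1 :=
  sum_boltzmann Set.univ_nonempty β (qubitEnergy w)

theorem qubitDistribution_sumElim {N' : Type} [Fintype N'] [DecidableEq N'] (β : ℝ) (w : N → ℝ)
    (w' : N' → ℝ) (z : N ⊕ N' → Bool) :
    qubitDistribution β (Sum.elim w w') z =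
      qubitDistribution β w (z ∘ Sum.inl) * qubitDistribution β w' (z ∘ Sum.inr) := by
  simp [qubitDistribution_eq_prod, Fintype.prod_sum_type]

/-- The environment of qubits with excitation energies `w`. -/
noncomputable abbrev qubitEnvironment (w : N → ℝ) : Environment where
  ι := N
  X _ := Bool
  ham i := Matrix.diagonal fun b => (qubitLevel (w i) b : ℂ)
  isHermitian_ham _ := Matrix.isHermitian_diagonal_of_self_adjoint _ <|
    funext fun _ => Complex.conj_ofReal _

theorem totalHam_qubitEnvironment (w : N → ℝ) :
    (qubitEnvironment w).totalHam = Matrix.diagonal fun z => (qubitEnergy w z : ℂ) := by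
  simp only [qubitEnergy, Complex.ofReal_sum]
  exact sum_localOperator_diagonal (X := fun _ : N => Bool) fun i b => (qubitLevel (w i) b : ℂ)

theorem jointHam_qubitEnvironment {m : Type*} [DecidableEq m] (w : N → ℝ) (d : m → ℂ) :
    (qubitEnvironment w).jointHam (Matrix.diagonal d) =
      Matrix.diagonal fun x => d x.1 + qubitEnergy w x.2 := by
  rw [Environment.jointHam, totalHam_qubitEnvironment, ← Matrix.diagonal_one,
    ← Matrix.diagonal_one, Matrix.diagonal_kronecker_diagonal, Matrix.diagonal_kronecker_diagonal,
    Matrix.diagonal_add]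
  simp only [mul_one, one_mul]

theorem apply_self_of_mem_microstates_qubit {β w : ℝ} (hw : w ≠ 0) {σ : Matrix Bool Bool ℂ}
    (hσ : σ ∈ microstates (thermalEnergy β (Matrix.diagonal fun b => (qubitLevel w b : ℂ)))
      (Matrix.diagonal fun b => (qubitLevel w b : ℂ))) (b : Bool) :
    σ b b = boltzmann Set.univ β (qubitLevel w) b := by
  have hone : (1 : Matrix Bool Bool ℂ) ∈ Matrix.unitaryGroup Bool ℂ := one_mem _
  have hham : Matrix.diagonal (fun b => (qubitLevel w b : ℂ)) =
      spectralMatrix 1 (qubitLevel w) := by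
    simp [spectralMatrix]
  have htrue : population 1 σ true = boltzmann Set.univ β (qubitLevel w) true := by
    have henergy := hσ.2
    rw [thermalEnergy, hham, gibbs_spectralMatrix hone, meanEnergy_spectralMatrix,
      meanEnergy_spectralMatrix, population_spectralMatrix hone] at henergy
    simpa [qubitLevel, hw] using henergy
  have hsum := hσ.1.sum_population hone
  rw [← sum_boltzmann Set.univ_nonempty β (qubitLevel w), Fintype.sum_bool, Fintype.sum_bool,
    htrue] at hsum
  have hpop : population 1 σ b = boltzmann Set.univ β (qubitLevel w) b := by
    cases b
    exacts [add_left_cancel hsum, htrue]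
  rw [← hpop, ← hσ.1.ofReal_re_diag]
  simp [population]

theorem Environment.IsThermal.tensorProd_apply_self {β : ℝ} {w : N → ℝ} (hw : ∀ i, w i ≠ 0)
    {σ : N → Matrix Bool Bool ℂ} (hσ : (qubitEnvironment w).IsThermal β σ) (z : N → Bool) :
    tensorProd σ z z = qubitDistribution β w z := by
  rw [qubitDistribution_eq_prod, Complex.ofReal_prod]
  exact Finset.prod_congr rfl fun i _ => apply_self_of_mem_microstates_qubit (hw i) (hσ i) _

end Qubits

section ConditionalBoltzmann

variable {m q : Type*} [Fintype m] [Fintype q]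

theorem boltzmann_apply_embedding (L : Set m) (b : ℝ) (h : m → ℝ) {g : q → m} (hg : ∀ i, g i ∈ L)
    (i : q) :
    boltzmann L b h (g i) = (∑ j, boltzmann L b h (g j)) * boltzmann Set.univ b (h ∘ g) i := by
  have hweight : ∀ j, boltzmannWeight L b h (g j) = boltzmannWeight Set.univ b (h ∘ g) j :=
    fun j => by simp [boltzmannWeight, hg j]
  have hsum := (sum_boltzmannWeight_pos ⟨i, Set.mem_univ i⟩ b (h ∘ g)).ne'
  simp only [boltzmann, hweight, ← Finset.sum_div]
  field_simp

theorem boltzmann_range_apply (f : q ↪ m) (b : ℝ) (h : m → ℝ) (i : q) :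
    boltzmann (Set.range f) b h (f i) = boltzmann Set.univ b (h ∘ f) i := by
  have hsum : ∑ j, boltzmann (Set.range f) b h (f j) = 1 := by
    rw [← sum_boltzmann ⟨f i, Set.mem_range_self i⟩ b h]
    exact Fintype.sum_of_injective f f.injective _ _ (fun _ hl => boltzmann_of_notMem b h hl)
      fun _ => rfl
  rw [boltzmann_apply_embedding _ b h Set.mem_range_self, hsum, one_mul]

end ConditionalBoltzmann

section OneHot

variable {m : Type*} {Q : Type} [DecidableEq Q]

/-- The configuration in which exactly the qubit `q` is excited. -/
def oneHot (q : Q) : Q → Bool := fun j => decide (j = q)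

theorem oneHot_injective : Function.Injective (oneHot : Q → Q → Bool) := fun a b h => by
  simpa [oneHot] using congrFun h a

theorem qubitEnergy_oneHot [Fintype Q] (w : Q → ℝ) (q : Q) : qubitEnergy w (oneHot q) = w q := by
  simp [qubitEnergy, qubitLevel, oneHot]

/-- The pairs of a level in the range of `f` and a one-hot configuration of the qubits. -/
def oneHotEmbedding (f : Q ↪ m) : Q × Q ↪ m × (Q → Bool) where
  toFun x := (f x.1, oneHot x.2)
  inj' x y h := by
    rw [Prod.mk.injEq] at h
    exact Prod.ext (f.injective h.1) (oneHot_injective h.2)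

variable [DecidableEq m] [Fintype Q]

/-- The exchange of the level `f q` with the one-hot configuration of the qubits, which fixes all
other levels and configurations. -/
noncomputable def oneHotSwap (f : Q ↪ m) : Equiv.Perm (m × (Q → Bool)) :=
  Equiv.Perm.viaFintypeEmbedding (Equiv.prodComm Q Q) (oneHotEmbedding f)

theorem oneHotSwap_apply (f : Q ↪ m) (q q' : Q) :
    oneHotSwap f (f q, oneHot q') = (f q', oneHot q) :=
  Equiv.Perm.viaFintypeEmbedding_apply_image _ (oneHotEmbedding f) (q, q')

theorem oneHotSwap_of_notMem (f : Q ↪ m) {x : m × (Q → Bool)}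
    (hx : x ∉ Set.range (oneHotEmbedding f)) : oneHotSwap f x = x :=
  Equiv.Perm.viaFintypeEmbedding_apply_notMem_range _ _ hx

theorem oneHotSwap_symm_apply (f : Q ↪ m) (q q' : Q) :
    (oneHotSwap f).symm (f q, oneHot q') = (f q', oneHot q) := by
  rw [Equiv.symm_apply_eq, oneHotSwap_apply]

theorem oneHotSwap_symm_of_notMem (f : Q ↪ m) {x : m × (Q → Bool)}
    (hx : x ∉ Set.range (oneHotEmbedding f)) : (oneHotSwap f).symm x = x := by
  rw [Equiv.symm_apply_eq, oneHotSwap_of_notMem f hx]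

theorem oneHotSwap_energy (f : Q ↪ m) (k : m → ℝ) (c : ℝ) (x : m × (Q → Bool)) :
    k (oneHotSwap f x).1 + qubitEnergy (fun q => k (f q) + c) (oneHotSwap f x).2 =
      k x.1 + qubitEnergy (fun q => k (f q) + c) x.2 := by
  by_cases hx : x ∈ Set.range (oneHotEmbedding f)
  · obtain ⟨⟨q, q'⟩, rfl⟩ := hx
    change k (oneHotSwap f (f q, oneHot q')).1 + qubitEnergy _ (oneHotSwap f (f q, oneHot q')).2 =
      k (f q) + qubitEnergy _ (oneHot q')
    rw [oneHotSwap_apply, qubitEnergy_oneHot, qubitEnergy_oneHot]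
    ring
  · rw [oneHotSwap_of_notMem f hx]

theorem sum_oneHotSwap_of_notMem (f : Q ↪ m) (P : (Q → Bool) → ℝ) (p : m → ℝ) {l : m}
    (hl : l ∉ Set.range f) :
    ∑ z, p ((oneHotSwap f).symm (l, z)).1 * P ((oneHotSwap f).symm (l, z)).2 =
      p l * ∑ z, P z := by
  have hfix : ∀ z, (oneHotSwap f).symm (l, z) = (l, z) := fun z => by
    refine oneHotSwap_symm_of_notMem f ?_
    rintro ⟨⟨q, _⟩, h⟩
    exact hl ⟨q, congrArg Prod.fst h⟩
  simp only [hfix, Finset.mul_sum]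

theorem sum_oneHotSwap [Fintype m] (f : Q ↪ m) (P : (Q → Bool) → ℝ) {p : m → ℝ}
    (hp : ∀ l ∉ Set.range f, p l = 0) (q : Q) :
    ∑ z, p ((oneHotSwap f).symm (f q, z)).1 * P ((oneHotSwap f).symm (f q, z)).2 =
      p (f q) * (∑ z, P z - ∑ q', P (oneHot q')) + (∑ l, p l) * P (oneHot q) := by
  have hchange : ∑ q', (p (f q') * P (oneHot q) - p (f q) * P (oneHot q')) =
      ∑ z, (p ((oneHotSwap f).symm (f q, z)).1 * P ((oneHotSwap f).symm (f q, z)).2 -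
        p (f q) * P z) := by
    refine Fintype.sum_of_injective oneHot oneHot_injective _ _ (fun z hz => ?_) fun q' => ?_
    · rw [oneHotSwap_symm_of_notMem, sub_self]
      rintro ⟨⟨_, q'⟩, h⟩
      exact hz ⟨q', congrArg Prod.snd h⟩
    · rw [oneHotSwap_symm_apply]
  have htotal : ∑ q', p (f q') = ∑ l, p l :=
    Fintype.sum_of_injective f f.injective _ _ hp fun _ => rfl
  rw [Finset.sum_sub_distrib, Finset.sum_sub_distrib, ← Finset.sum_mul, ← Finset.mul_sum,
    ← Finset.mul_sum, htotal] at hchange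
  linarith

end OneHot

/-- An energy-conserving permutation of the joint levels of a system with energy levels `k` and of
finitely many qubits. The excitation energies are nonzero, so that the populations of a qubit are
determined by its mean energy. -/
structure QubitOperation {m : Type*} (k : m → ℝ) where
  /-- labels of the qubits -/
  N : Type
  [fintypeLabel : Fintype N]
  [decEqLabel : DecidableEq N]
  /-- the excitation energies -/
  w : N → ℝ
  w_ne_zero : ∀ i, w i ≠ 0
  /-- the permutation of the joint levels -/
  perm : Equiv.Perm (m × (N → Bool))
  energy_perm : ∀ x, k (perm x).1 + qubitEnergy w (perm x).2 = k x.1 + qubitEnergy w x.2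

attribute [instance] QubitOperation.fintypeLabel QubitOperation.decEqLabel

namespace QubitOperation

variable {m : Type*} {k : m → ℝ}

/-- The distribution of the levels after the operation, for the initial distribution `p` of the
levels and thermal qubits. -/
noncomputable def push (T : QubitOperation k) (β : ℝ) (p : m → ℝ) (l : m) : ℝ :=
  ∑ z, p (T.perm.symm (l, z)).1 * qubitDistribution β T.w (T.perm.symm (l, z)).2

/-- The operation without qubits that leaves all levels unchanged. -/
def idle (k : m → ℝ) : QubitOperation k where
  N := Empty
  w := Empty.elim
  w_ne_zero i := i.elim
  perm := Equiv.refl _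
  energy_perm _ := rfl

theorem push_idle (β : ℝ) (p : m → ℝ) : (idle k).push β p = p := by
  ext l
  change ∑ z, p l * qubitDistribution β Empty.elim z = p l
  rw [← Finset.mul_sum, sum_qubitDistribution, mul_one]

/-- The operation `T` followed by `T'`, each with its own qubits. -/
def comp (T T' : QubitOperation k) : QubitOperation k where
  N := T.N ⊕ T'.N
  w := Sum.elim T.w T'.w
  w_ne_zero := Sum.rec T.w_ne_zero T'.w_ne_zero
  perm :=
    { toFun := fun x =>
        let y := T.perm (x.1, x.2 ∘ Sum.inl)
        let y' := T'.perm (y.1, x.2 ∘ Sum.inr)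
        (y'.1, Sum.elim y.2 y'.2)
      invFun := fun x =>
        let y' := T'.perm.symm (x.1, x.2 ∘ Sum.inr)
        let y := T.perm.symm (y'.1, x.2 ∘ Sum.inl)
        (y.1, Sum.elim y.2 y'.2)
      left_inv := fun x => by simp
      right_inv := fun x => by simp }
  energy_perm x := by
    have hT := T.energy_perm (x.1, x.2 ∘ Sum.inl)
    have hT' := T'.energy_perm ((T.perm (x.1, x.2 ∘ Sum.inl)).1, x.2 ∘ Sum.inr)
    simp only [qubitEnergy_sumElim, Equiv.coe_fn_mk, Sum.elim_comp_inl, Sum.elim_comp_inr]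
    simp only at hT hT'
    linarith

theorem push_comp (T T' : QubitOperation k) (β : ℝ) (p : m → ℝ) :
    (T.comp T').push β p = T'.push β (T.push β p) := by
  ext l
  simp only [push, Finset.sum_mul]
  rw [← Fintype.sum_prod_type_right', ← (Equiv.sumArrowEquivProdArrow T.N T'.N Bool).sum_comp]
  exact Finset.sum_congr rfl fun z _ =>
    (congrArg _ (qubitDistribution_sumElim β T.w T'.w _)).trans (mul_assoc _ _ _).symm

section Swap

variable {Q : Type} [Fintype Q]

/-- The energies of the levels `f q`, shifted so that all of them are positive. -/
noncomputable def swapEnergy (k : m → ℝ) (f : Q ↪ m) (q : Q) : ℝ :=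
  k (f q) + (1 + ∑ q', |k (f q')|)

theorem swapEnergy_pos (k : m → ℝ) (f : Q ↪ m) (q : Q) : 0 < swapEnergy k f q := by
  have hle := Finset.single_le_sum (f := fun q => |k (f q)|) (fun _ _ => abs_nonneg _)
    (Finset.mem_univ q)
  have habs := neg_abs_le (k (f q))
  rw [swapEnergy]
  linarith

variable [DecidableEq Q]

/-- The probability that exactly one of the thermal qubits with excitation energies
`swapEnergy k f` is excited. -/
noncomputable def swapRate (β : ℝ) (k : m → ℝ) (f : Q ↪ m) : ℝ :=
  ∑ q, qubitDistribution β (swapEnergy k f) (oneHot q)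

theorem swapRate_pos [Nonempty Q] (β : ℝ) (k : m → ℝ) (f : Q ↪ m) : 0 < swapRate β k f := by
  refine Finset.sum_pos (fun q _ => div_pos ?_ (sum_boltzmannWeight_pos Set.univ_nonempty _ _))
    Finset.univ_nonempty
  simpa [boltzmannWeight] using Real.exp_pos _

theorem swapRate_le_one (β : ℝ) (k : m → ℝ) (f : Q ↪ m) : swapRate β k f ≤ 1 := by
  rw [swapRate, ← sum_qubitDistribution β (swapEnergy k f),
    ← Finset.sum_image (f := qubitDistribution β (swapEnergy k f)) oneHot_injective.injOn]
  exact Finset.sum_le_sum_of_subset_of_nonneg (Finset.subset_univ _)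
    fun _ _ _ => boltzmann_nonneg _ _ _ _

/-- The swap of the levels in the range of `f` with the one-hot configurations of qubits whose
excitation energies are the shifted energies of these levels. -/
noncomputable def swap [DecidableEq m] (k : m → ℝ) (f : Q ↪ m) : QubitOperation k where
  N := Q
  w := swapEnergy k f
  w_ne_zero q := (swapEnergy_pos k f q).ne'
  perm := oneHotSwap f
  energy_perm := oneHotSwap_energy f k _

variable [Fintype m]

theorem qubitDistribution_swapEnergy_oneHot (β : ℝ) (k : m → ℝ) (f : Q ↪ m) (q : Q) :
    qubitDistribution β (swapEnergy k f) (oneHot q) =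
      swapRate β k f * boltzmann (Set.range f) β k (f q) := by
  have henergy : qubitEnergy (swapEnergy k f) ∘ oneHot =
      fun q => (k ∘ f) q - -(1 + ∑ q', |k (f q')|) := by
    ext q
    rw [Function.comp_apply, qubitEnergy_oneHot, sub_neg_eq_add]
    rfl
  rw [boltzmann_range_apply, ← boltzmann_sub_const _ _ _ (-(1 + ∑ q', |k (f q')|)), ← henergy]
  exact boltzmann_apply_embedding _ β _ (fun _ => Set.mem_univ _) q

theorem push_swap [DecidableEq m] (β : ℝ) (k : m → ℝ) (f : Q ↪ m) {p : m → ℝ}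
    (hp : ∀ l ∉ Set.range f, p l = 0)
    (hsum : ∑ l, p l = 1) :
    (swap k f).push β p =
      fun l => (1 - swapRate β k f) * p l + swapRate β k f * boltzmann (Set.range f) β k l := by
  ext l
  by_cases hl : l ∈ Set.range f
  · obtain ⟨q, rfl⟩ := hl
    have hswap := sum_oneHotSwap f (qubitDistribution β (swapEnergy k f)) hp q
    rw [sum_qubitDistribution, hsum, qubitDistribution_swapEnergy_oneHot] at hswap
    rw [mul_comm (1 - _), ← one_mul (swapRate β k f * _)]
    exact hswap
  · rw [hp l hl, boltzmann_of_notMem β k hl, mul_zero, mul_zero, add_zero]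
    refine (sum_oneHotSwap_of_notMem f (qubitDistribution β (swapEnergy k f)) p hl).trans ?_
    rw [hp l hl, zero_mul]

end Swap

variable [Fintype m] {L : Set m}

/-- The levels are driven towards the thermal distribution on `L`, up to a remainder `a`. -/
def ThermalizesUpTo (T : QubitOperation k) (β : ℝ) (L : Set m) (a : ℝ) : Prop :=
  ∀ p : m → ℝ, (∀ l ∉ L, p l = 0) → ∑ l, p l = 1 →
    T.push β p = fun l => a * p l + (1 - a) * boltzmann L β k l

theorem ThermalizesUpTo.comp {T T' : QubitOperation k} {β a a' : ℝ} (hL : L.Nonempty)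
    (hT : T.ThermalizesUpTo β L a) (hT' : T'.ThermalizesUpTo β L a') :
    (T.comp T').ThermalizesUpTo β L (a' * a) := fun p hp hsum => by
  have hsupp : ∀ l ∉ L, a * p l + (1 - a) * boltzmann L β k l = 0 := fun l hl => by
    rw [hp l hl, boltzmann_of_notMem β k hl, mul_zero, mul_zero, add_zero]
  have htotal : ∑ l, (a * p l + (1 - a) * boltzmann L β k l) = 1 := by
    rw [Finset.sum_add_distrib, ← Finset.mul_sum, ← Finset.mul_sum, hsum, sum_boltzmann hL]
    ring
  rw [push_comp, hT p hp hsum, hT' _ hsupp htotal]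
  ext l
  ring

theorem exists_thermalizesUpTo (k : m → ℝ) (β : ℝ) (hL : L.Nonempty) {η : ℝ} (hη : 0 < η) :
    ∃ T : QubitOperation k, ∃ a, 0 ≤ a ∧ a ≤ η ∧ T.ThermalizesUpTo β L a := by
  classical
  obtain ⟨d, f, rfl⟩ := L.toFinite.fin_embedding
  have : Nonempty (Fin d) := Set.range_nonempty_iff_nonempty.1 hL
  have hrate : 0 ≤ 1 - swapRate β k f := sub_nonneg.2 (swapRate_le_one β k f)
  have hiterate : ∀ K : ℕ, ∃ T : QubitOperation k,
      T.ThermalizesUpTo β (Set.range f) ((1 - swapRate β k f) ^ K) := fun K => by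
    induction K with
    | zero => exact ⟨idle k, fun p _ _ => by simp [push_idle]⟩
    | succ K ih =>
      obtain ⟨T, hT⟩ := ih
      refine ⟨T.comp (swap k f), pow_succ' (1 - swapRate β k f) K ▸ hT.comp hL ?_⟩
      exact fun p hp hsum => by rw [push_swap β k f hp hsum, sub_sub_cancel]
  obtain ⟨K, hK⟩ := exists_pow_lt_of_lt_one hη (sub_lt_self 1 (swapRate_pos β k f))
  obtain ⟨T, hT⟩ := hiterate K
  exact ⟨T, _, pow_nonneg hrate K, hK.le, hT⟩

end QubitOperation

section Reindex

variable {a b : Type*} [Fintype a] [Fintype b] (g : a ≃ b)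

theorem submatrix_mem_unitaryGroup [DecidableEq a] [DecidableEq b] {V : Matrix b b ℂ}
    (hV : V ∈ Matrix.unitaryGroup b ℂ) : V.submatrix g g ∈ Matrix.unitaryGroup a ℂ := by
  rw [Matrix.mem_unitaryGroup_iff, Matrix.star_eq_conjTranspose, Matrix.conjTranspose_submatrix,
    Matrix.submatrix_mul_equiv, unitary_mul_conjTranspose hV, Matrix.submatrix_one_equiv]

theorem conj_submatrix (V A : Matrix b b ℂ) :
    V.submatrix g g * A.submatrix g g * (V.submatrix g g)ᴴ = (V * A * Vᴴ).submatrix g g := by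
  rw [Matrix.conjTranspose_submatrix, Matrix.submatrix_mul_equiv, Matrix.submatrix_mul_equiv]

theorem commute_submatrix {A B : Matrix b b ℂ} (h : Commute A B) :
    Commute (A.submatrix g g) (B.submatrix g g) := by
  rw [commute_iff_eq, Matrix.submatrix_mul_equiv, Matrix.submatrix_mul_equiv, h.eq]

theorem meanEnergy_submatrix (K A : Matrix b b ℂ) :
    meanEnergy (K.submatrix g g) (A.submatrix g g) = meanEnergy K A := by
  rw [meanEnergy, meanEnergy, Matrix.submatrix_mul_equiv]
  exact congrArg Complex.re (g.sum_comp fun i => (A * K) i i)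

theorem permMatrix_conj [DecidableEq a] (π : Equiv.Perm a) (A : Matrix a a ℂ) :
    π.permMatrix ℂ * A * (π.permMatrix ℂ)ᴴ = A.submatrix π π := by
  ext i j
  simp [Equiv.Perm.permMatrix, PEquiv.toMatrix_toPEquiv_mul, Matrix.mul_apply,
    PEquiv.toMatrix_apply, Equiv.symm_apply_eq]

theorem permMatrix_mem_unitaryGroup [DecidableEq a] (π : Equiv.Perm a) :
    π.permMatrix ℂ ∈ Matrix.unitaryGroup a ℂ := by
  have hone := permMatrix_conj π 1
  rwa [Matrix.mul_one, Matrix.submatrix_one_equiv, ← Matrix.star_eq_conjTranspose,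
    ← Matrix.mem_unitaryGroup_iff] at hone

theorem commute_permMatrix_diagonal [DecidableEq a] {π : Equiv.Perm a} {d : a → ℂ}
    (hd : ∀ i, d (π i) = d i) : Commute (π.permMatrix ℂ) (Matrix.diagonal d) := by
  ext i j
  by_cases hij : π i = j
  · simp [Equiv.Perm.permMatrix, PEquiv.toMatrix_apply, ← hij, hd]
  · simp [Equiv.Perm.permMatrix, PEquiv.toMatrix_apply, hij]

end Reindex

section PartialTraceDensity

variable {m z : Type*} [Fintype m] [Fintype z]

theorem IsDensityMatrix.partialTrace {X : Matrix (m × z) (m × z) ℂ} (hX : IsDensityMatrix X) :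
    IsDensityMatrix (partialTrace X) := by
  have hsum : _root_.partialTrace X = ∑ k, X.submatrix (·, k) (·, k) := by
    ext i j
    simp [_root_.partialTrace, Matrix.sum_apply]
  refine ⟨hsum ▸ Matrix.posSemidef_sum _ fun k _ => hX.1.submatrix _, ?_⟩
  rw [← hX.2]
  exact (Fintype.sum_prod_type fun x => X x x).symm

end PartialTraceDensity

section Dephasing

/-- The polarization of a thermal qubit with excitation energy `w`, the difference of its
populations. -/
noncomputable def polarization (β w : ℝ) : ℝ :=
  boltzmann Set.univ β (qubitLevel w) false - boltzmann Set.univ β (qubitLevel w) true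

theorem tendsto_polarization_zero (β : ℝ) : Tendsto (polarization β) (𝓝 0) (𝓝 0) := by
  have hscale : polarization β = fun w => boltzmann Set.univ (β * w) (qubitLevel 1) false -
      boltzmann Set.univ (β * w) (qubitLevel 1) true := by
    ext w
    have hlevel : qubitLevel w = w • qubitLevel 1 := by
      ext b
      cases b <;> simp [qubitLevel]
    rw [← boltzmann_smul, ← hlevel, polarization]
  have hzero : polarization β 0 = 0 := by simp [hscale, boltzmann, boltzmannWeight]
  have hcont := (continuous_boltzmann_univ (qubitLevel 1)).comp (continuous_const_mul β)
  nth_rw 2 [← hzero]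
  rw [hscale]
  exact (((continuous_apply false).comp hcont).sub ((continuous_apply true).comp hcont)).tendsto 0

theorem exists_ne_zero_polarization_sq_le (β : ℝ) {η : ℝ} (hη : 0 < η) :
    ∃ w, w ≠ 0 ∧ polarization β w ^ 2 ≤ η := by
  have htendsto := ((tendsto_polarization_zero β).pow 2).mono_left (nhdsWithin_le_nhds (s := {0}ᶜ))
  rw [zero_pow two_ne_zero] at htendsto
  obtain ⟨w, hle, hw⟩ := ((htendsto.eventually_le_const hη).and self_mem_nhdsWithin).exists
  exact ⟨w, hw, hle⟩

variable {J : Type}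

/-- The phase `-1` for the configurations `y` in which the qubit `j` is excited. -/
def qubitPhase (j : J) (y : J → Bool) : ℝ := if y j then -1 else 1

theorem qubitPhase_mul_self (j : J) (y : J → Bool) : qubitPhase j y * qubitPhase j y = 1 := by
  unfold qubitPhase
  split_ifs <;> norm_num

variable [Fintype J] {x : Type*} [DecidableEq x]

/-- The unitary that flips the sign of a level `a` when the qubit `g a` is excited. -/
def dephasing (g : x → J) : Matrix (x × (J → Bool)) (x × (J → Bool)) ℂ :=
  Matrix.diagonal fun a => (qubitPhase (g a.1) a.2 : ℂ)

theorem conjTranspose_dephasing (g : x → J) : (dephasing g)ᴴ = dephasing g := by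
  rw [dephasing, Matrix.diagonal_conjTranspose]
  congr 1
  ext a
  exact Complex.conj_ofReal _

variable [DecidableEq J]

theorem sum_qubitPhase_mul_qubitDistribution (β w : ℝ) (i j : J) :
    ∑ y, qubitPhase i y * qubitPhase j y * qubitDistribution β (fun _ => w) y =
      if i = j then 1 else polarization β w ^ 2 := by
  split_ifs with hij
  · simp only [hij, qubitPhase_mul_self, one_mul, sum_qubitDistribution]
  set P := boltzmann Set.univ β (qubitLevel w) with hP
  have hPsum : P true + P false = 1 := by
    rw [← Fintype.sum_bool, hP, sum_boltzmann Set.univ_nonempty]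
  let φ (l : J) (b : Bool) : ℝ := if (l = i ∨ l = j) ∧ b then -1 else 1
  have hphase : ∀ y, qubitPhase i y * qubitPhase j y = ∏ l, φ l (y l) := fun y => by
    rw [← Finset.prod_subset (Finset.subset_univ {i, j}) fun l _ hl => ?_, Finset.prod_pair hij]
    · simp [φ, qubitPhase]
    · simp_all [φ]
  calc ∑ y : J → Bool, qubitPhase i y * qubitPhase j y * qubitDistribution β (fun _ => w) y
      = ∑ y : J → Bool, ∏ l, φ l (y l) * P (y l) := by
        simp only [hphase, qubitDistribution_eq_prod, Finset.prod_mul_distrib, hP]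
    _ = ∏ l, ∑ b, φ l b * P b := by rw [Finset.prod_univ_sum, Fintype.piFinset_univ]
    _ = ∏ l ∈ {i, j}, ∑ b, φ l b * P b := by
        refine (Finset.prod_subset (Finset.subset_univ _) fun l _ hl => ?_).symm
        simp_all [φ]
    _ = polarization β w ^ 2 := by
        rw [Finset.prod_pair hij]
        simp only [φ, Fintype.sum_bool, true_or, or_true, and_true, Bool.false_eq_true, and_false,
          if_true, if_false, polarization, ← hP]
        ring

variable [Fintype x]

theorem dephasing_mem_unitaryGroup (g : x → J) :
    dephasing g ∈ Matrix.unitaryGroup (x × (J → Bool)) ℂ := by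
  rw [Matrix.mem_unitaryGroup_iff, Matrix.star_eq_conjTranspose, conjTranspose_dephasing,
    dephasing, Matrix.diagonal_mul_diagonal]
  simp only [← Complex.ofReal_mul, qubitPhase_mul_self, Complex.ofReal_one, Matrix.diagonal_one]

theorem commute_dephasing_jointHam (g : x → J) (w : J → ℝ) (d : x → ℂ) :
    Commute (dephasing g) ((qubitEnvironment w).jointHam (Matrix.diagonal d)) := by
  rw [jointHam_qubitEnvironment]
  exact Matrix.commute_diagonal _ _

theorem partialTrace_dephasing_conj_apply {β w : ℝ} (hw : w ≠ 0) {σ : J → Matrix Bool Bool ℂ}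
    (hσ : (qubitEnvironment fun _ : J => w).IsThermal β σ) (g : x → J) (D : Matrix x x ℂ)
    (a b : x) :
    partialTrace (dephasing g * (D ⊗ₖ tensorProd σ) * (dephasing g)ᴴ) a b =
      (if g a = g b then 1 else polarization β w ^ 2 : ℝ) * D a b := by
  rw [← sum_qubitPhase_mul_qubitDistribution, conjTranspose_dephasing, Complex.ofReal_sum,
    Finset.sum_mul]
  refine Finset.sum_congr rfl fun y _ => ?_
  rw [dephasing, Matrix.mul_diagonal, Matrix.diagonal_mul, Matrix.kroneckerMap_apply,
    hσ.tensorProd_apply_self (fun _ => hw)]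
  push_cast
  ring

end Dephasing

namespace QubitOperation

variable {m : Type*} [DecidableEq m] {k : m → ℝ}

/-- The unitary that permutes the joint levels by `T.perm`. -/
def unitary (T : QubitOperation k) : Matrix (m × (T.N → Bool)) (m × (T.N → Bool)) ℂ :=
  Equiv.Perm.permMatrix ℂ T.perm.symm

variable [Fintype m]

theorem unitary_mem_unitaryGroup (T : QubitOperation k) :
    T.unitary ∈ Matrix.unitaryGroup (m × (T.N → Bool)) ℂ :=
  permMatrix_mem_unitaryGroup _

theorem commute_unitary_jointHam (T : QubitOperation k) :
    Commute T.unitary ((qubitEnvironment T.w).jointHam (Matrix.diagonal fun l => (k l : ℂ))) := by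
  rw [jointHam_qubitEnvironment]
  refine commute_permMatrix_diagonal fun x => ?_
  have henergy := T.energy_perm (T.perm.symm x)
  rw [Equiv.apply_symm_apply] at henergy
  exact_mod_cast henergy.symm

theorem partialTrace_unitary_conj_apply_self (T : QubitOperation k) {β : ℝ} {ρ : Matrix m m ℂ}
    (hρ : IsDensityMatrix ρ) {σ : T.N → Matrix Bool Bool ℂ}
    (hσ : (qubitEnvironment T.w).IsThermal β σ) (l : m) :
    partialTrace (T.unitary * (ρ ⊗ₖ tensorProd σ) * T.unitaryᴴ) l l =
      T.push β (fun i => (ρ i i).re) l := by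
  rw [push, Complex.ofReal_sum, unitary, permMatrix_conj]
  refine Finset.sum_congr rfl fun z _ => ?_
  rw [Matrix.submatrix_apply, Matrix.kroneckerMap_apply, hσ.tensorProd_apply_self T.w_ne_zero,
    Complex.ofReal_mul, hρ.ofReal_re_diag]

end QubitOperation

namespace Environment

variable {n : Type*} {E F : Environment}

theorem IsThermal.inl {β : ℝ} {σ : ∀ i, Matrix ((E.sum F).X i) ((E.sum F).X i) ℂ}
    (hσ : (E.sum F).IsThermal β σ) : E.IsThermal β fun i => σ (Sum.inl i) :=
  fun i => hσ (Sum.inl i)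

theorem IsThermal.inr {β : ℝ} {σ : ∀ i, Matrix ((E.sum F).X i) ((E.sum F).X i) ℂ}
    (hσ : (E.sum F).IsThermal β σ) : F.IsThermal β fun i => σ (Sum.inr i) :=
  fun i => hσ (Sum.inr i)

theorem commute_kronecker_one_jointHam [Fintype n] [DecidableEq n] {P A : Matrix n n ℂ}
    (h : Commute P A) : Commute (P ⊗ₖ (1 : Matrix E.Basis E.Basis ℂ)) (E.jointHam A) := by
  rw [commute_iff_eq, jointHam, mul_add, add_mul, ← Matrix.mul_kronecker_mul,
    ← Matrix.mul_kronecker_mul, ← Matrix.mul_kronecker_mul, ← Matrix.mul_kronecker_mul, h.eq]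
  simp only [mul_one, one_mul]

theorem conj_kronecker_one_jointHam [Fintype n] [DecidableEq n] {W : Matrix n n ℂ}
    (hW : W ∈ Matrix.unitaryGroup n ℂ) (A : Matrix n n ℂ) :
    (W ⊗ₖ (1 : Matrix E.Basis E.Basis ℂ)) * E.jointHam A *
      (W ⊗ₖ (1 : Matrix E.Basis E.Basis ℂ))ᴴ = E.jointHam (W * A * Wᴴ) := by
  rw [Matrix.conjTranspose_kronecker, Matrix.conjTranspose_one, jointHam, mul_add, add_mul,
    ← Matrix.mul_kronecker_mul, ← Matrix.mul_kronecker_mul, ← Matrix.mul_kronecker_mul,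
    ← Matrix.mul_kronecker_mul, Matrix.mul_one W, unitary_mul_conjTranspose hW, jointHam]
  simp only [mul_one, one_mul]

theorem conj_kronecker_tensorProd_sum [Fintype n] (Y : Matrix ((n × E.Basis) × F.Basis) _ ℂ)
    (ρ : Matrix n n ℂ) (σ : ∀ i, Matrix ((E.sum F).X i) ((E.sum F).X i) ℂ) :
    Y.submatrix (E.jointBasisSum F n) (E.jointBasisSum F n) * (ρ ⊗ₖ tensorProd σ) *
      (Y.submatrix (E.jointBasisSum F n) (E.jointBasisSum F n))ᴴ =
    (Y * ((ρ ⊗ₖ tensorProd (X := E.X) fun i => σ (Sum.inl i)) ⊗ₖ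
      tensorProd (X := F.X) fun i => σ (Sum.inr i)) * Yᴴ).submatrix
        (E.jointBasisSum F n) (E.jointBasisSum F n) := by
  rw [kronecker_tensorProd_sum, conj_submatrix]

theorem partialTrace_submatrix_jointBasisSum (X : Matrix ((n × E.Basis) × F.Basis) _ ℂ) :
    partialTrace (X.submatrix (E.jointBasisSum F n) (E.jointBasisSum F n)) =
      partialTrace (partialTrace X) :=
  partialTrace_submatrix_assoc (E.basisSum F) X

end Environment

section ThermalPreparation

variable {m : Type*}

theorem exists_forall_norm_sub_le_imp_mem [Finite m] {D₀ : Matrix m m ℂ} {s : Set (Matrix m m ℂ)}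
    (hs : s ∈ 𝓝 D₀) :
    ∃ η > 0, ∀ D : Matrix m m ℂ, (∀ i j, ‖D i j - D₀ i j‖ ≤ η) → D ∈ s := by
  cases nonempty_fintype m
  obtain ⟨δ, hδ, hball⟩ := Metric.mem_nhds_iff (α := m → m → ℂ).1 hs
  refine ⟨δ / 2, half_pos hδ, fun D hD => hball ?_⟩
  have hdist : dist (α := m → m → ℂ) D D₀ ≤ δ / 2 :=
    (dist_pi_le_iff (half_pos hδ).le).2 fun i =>
      (dist_pi_le_iff (half_pos hδ).le).2 fun j => (dist_eq_norm _ _).trans_le (hD i j)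
  exact hdist.trans_lt (half_lt_self hδ)

variable [Fintype m] [DecidableEq m]

/-- Using a thermal environment and an evolution conserving the total energy exactly, all states
in `𝒮` can be brought into any neighbourhood of `ω` at once, whatever the microstates of the
environment systems are. -/
def ThermallyPreparable (β : ℝ) (H : Matrix m m ℂ) (𝒮 : Set (Matrix m m ℂ)) (ω : Matrix m m ℂ) :
    Prop :=
  ∀ s ∈ 𝓝 ω, ∃ E : Environment, ∃ M ∈ Matrix.unitaryGroup (m × E.Basis) ℂ,
    Commute M (E.jointHam H) ∧ ∀ ρ ∈ 𝒮, ∀ σ : ∀ i, Matrix (E.X i) (E.X i) ℂ, E.IsThermal β σ →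
      partialTrace (M * (ρ ⊗ₖ tensorProd σ) * Mᴴ) ∈ s

theorem Environment.exists_sum_of_commute {E F : Environment} {β : ℝ} {H : Matrix m m ℂ}
    {𝒮 s : Set (Matrix m m ℂ)} {M : Matrix ((m × E.Basis) × F.Basis) ((m × E.Basis) × F.Basis) ℂ}
    (hM : M ∈ Matrix.unitaryGroup ((m × E.Basis) × F.Basis) ℂ)
    (hcomm : Commute M (F.jointHam (E.jointHam H)))
    (hs : ∀ ρ ∈ 𝒮, ∀ σ : ∀ i, Matrix (E.X i) (E.X i) ℂ, E.IsThermal β σ →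
      ∀ τ : ∀ i, Matrix (F.X i) (F.X i) ℂ, F.IsThermal β τ →
        partialTrace (partialTrace (M * ((ρ ⊗ₖ tensorProd σ) ⊗ₖ tensorProd τ) * Mᴴ)) ∈ s) :
    ∃ E' : Environment, ∃ M' ∈ Matrix.unitaryGroup (m × E'.Basis) ℂ,
      Commute M' (E'.jointHam H) ∧ ∀ ρ ∈ 𝒮, ∀ σ : ∀ i, Matrix (E'.X i) (E'.X i) ℂ,
        E'.IsThermal β σ → partialTrace (M' * (ρ ⊗ₖ tensorProd σ) * M'ᴴ) ∈ s := by
  refine ⟨E.sum F, _, submatrix_mem_unitaryGroup (E.jointBasisSum F m) hM, ?_, fun ρ hρ σ hσ => ?_⟩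
  · rw [jointHam_sum]
    exact commute_submatrix _ hcomm
  · rw [conj_kronecker_tensorProd_sum, partialTrace_submatrix_jointBasisSum]
    exact hs ρ hρ _ hσ.inl _ hσ.inr

theorem ThermallyPreparable.conj {β : ℝ} {H ω W : Matrix m m ℂ} {𝒮 : Set (Matrix m m ℂ)}
    (h : ThermallyPreparable β H 𝒮 ω) (hW : W ∈ Matrix.unitaryGroup m ℂ) :
    ThermallyPreparable β (W * H * Wᴴ) {ρ | Wᴴ * ρ * W ∈ 𝒮} (W * ω * Wᴴ) := by
  intro s hs
  have hcont : Continuous fun D : Matrix m m ℂ => W * D * Wᴴ := by fun_prop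
  obtain ⟨E, M, hM, hcomm, hprep⟩ := h _ (hcont.continuousAt hs)
  set V := W ⊗ₖ (1 : Matrix E.Basis E.Basis ℂ) with hV_def
  have hV : V ∈ Matrix.unitaryGroup (m × E.Basis) ℂ := kronecker_one_mem_unitaryGroup hW
  have hVV : Vᴴ * V = 1 := unitary_conjTranspose_mul hV
  refine ⟨E, V * M * Vᴴ, mul_mem (mul_mem hV hM) (conjTranspose_mem_unitaryGroup hV), ?_,
    fun ρ hρ σ hσ => ?_⟩
  · rw [← Environment.conj_kronecker_one_jointHam hW, ← hV_def, commute_iff_eq]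
    calc V * M * Vᴴ * (V * E.jointHam H * Vᴴ) = V * M * (Vᴴ * V) * E.jointHam H * Vᴴ := by
          noncomm_ring
      _ = V * E.jointHam H * (Vᴴ * V) * M * Vᴴ := by
          rw [hVV, Matrix.mul_one, Matrix.mul_one, Matrix.mul_assoc V, hcomm.eq,
            ← Matrix.mul_assoc V]
      _ = V * E.jointHam H * Vᴴ * (V * M * Vᴴ) := by noncomm_ring
  · have hinner : Vᴴ * (ρ ⊗ₖ tensorProd σ) * V = (Wᴴ * ρ * W) ⊗ₖ tensorProd σ := by
      rw [hV_def, Matrix.conjTranspose_kronecker, Matrix.conjTranspose_one,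
        ← Matrix.mul_kronecker_mul, ← Matrix.mul_kronecker_mul, Matrix.one_mul, Matrix.mul_one]
    have houter : V * M * Vᴴ * (ρ ⊗ₖ tensorProd σ) * (V * M * Vᴴ)ᴴ =
        V * (M * ((Wᴴ * ρ * W) ⊗ₖ tensorProd σ) * Mᴴ) * Vᴴ := by
      rw [← hinner]
      simp only [Matrix.conjTranspose_mul, Matrix.conjTranspose_conjTranspose, Matrix.mul_assoc]
    rw [houter, partialTrace_conj_kronecker_one]
    exact hprep _ hρ σ hσ

end ThermalPreparation

section DiagonalPreparation

variable {m : Type*} [Fintype m] [DecidableEq m]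

theorem partialTrace_partialTrace_dephasing_fst_apply {z : Type*} [Fintype z] [DecidableEq z]
    {J : Type} [Fintype J] [DecidableEq J] (e : m ↪ J) {β w : ℝ} (hw : w ≠ 0)
    {σ : J → Matrix Bool Bool ℂ} (hσ : (qubitEnvironment fun _ : J => w).IsThermal β σ)
    (D : Matrix (m × z) (m × z) ℂ) (i j : m) :
    partialTrace (partialTrace (dephasing (fun a : m × z => e a.1) * (D ⊗ₖ tensorProd σ) *
      (dephasing fun a : m × z => e a.1)ᴴ)) i j =
      (if i = j then 1 else polarization β w ^ 2 : ℝ) * partialTrace D i j := by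
  rw [partialTrace, Matrix.of_apply]
  simp only [partialTrace_dephasing_conj_apply hw hσ, e.injective.eq_iff, ← Finset.mul_sum]
  rfl

theorem QubitOperation.ThermalizesUpTo.norm_partialTrace_sub_le {k : m → ℝ} {T : QubitOperation k}
    {β a : ℝ} {L : Set m} (hT : T.ThermalizesUpTo β L a) (hL : L.Nonempty) (ha : 0 ≤ a)
    {ρ : Matrix m m ℂ} (hρ : IsDensityMatrix ρ) (hsupp : ∀ l ∉ L, ρ l l = 0)
    {σ : T.N → Matrix Bool Bool ℂ} (hσ : (qubitEnvironment T.w).IsThermal β σ) (l : m) :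
    ‖partialTrace (T.unitary * (ρ ⊗ₖ tensorProd σ) * T.unitaryᴴ) l l - boltzmann L β k l‖ ≤ a := by
  have hle : boltzmann L β k l ≤ 1 := by
    rw [← sum_boltzmann hL β k]
    exact Finset.single_le_sum (fun i _ => boltzmann_nonneg L β k i) (Finset.mem_univ l)
  have hnonneg := boltzmann_nonneg L β k l
  have hdiff : T.push β (fun i => (ρ i i).re) l - boltzmann L β k l =
      a * ((ρ l l).re - boltzmann L β k l) := by
    rw [hT _ (fun l hl => by rw [hsupp l hl, Complex.zero_re]) hρ.sum_re_diag]
    ring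
  rw [T.partialTrace_unitary_conj_apply_self hρ hσ, ← Complex.ofReal_sub, Complex.norm_real, hdiff,
    norm_mul, Real.norm_of_nonneg ha]
  refine mul_le_of_le_one_right ha (abs_le.2 ⟨?_, ?_⟩)
  · linarith [hρ.re_diag_nonneg l]
  · linarith [hρ.re_diag_le_one l]

/-- The operation `T`, followed by the dephasing of the system in the energy basis by one further
qubit per level. -/
noncomputable def QubitOperation.dephasedUnitary {k : m → ℝ} (T : QubitOperation k) :
    Matrix ((m × (T.N → Bool)) × (Fin (Fintype.card m) → Bool))
      ((m × (T.N → Bool)) × (Fin (Fintype.card m) → Bool)) ℂ :=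
  dephasing (fun x : m × (T.N → Bool) => Fintype.equivFin m x.1) * (T.unitary ⊗ₖ 1)

theorem QubitOperation.dephasedUnitary_mem_unitaryGroup {k : m → ℝ} (T : QubitOperation k) :
    T.dephasedUnitary ∈ Matrix.unitaryGroup _ ℂ :=
  mul_mem (dephasing_mem_unitaryGroup _) (kronecker_one_mem_unitaryGroup T.unitary_mem_unitaryGroup)

theorem QubitOperation.commute_dephasedUnitary_jointHam {k : m → ℝ} (T : QubitOperation k)
    (w : Fin (Fintype.card m) → ℝ) :
    Commute T.dephasedUnitary ((qubitEnvironment w).jointHam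
      ((qubitEnvironment T.w).jointHam (Matrix.diagonal fun l => (k l : ℂ)))) := by
  refine Commute.mul_left ?_ (Environment.commute_kronecker_one_jointHam (E := qubitEnvironment w)
    T.commute_unitary_jointHam)
  rw [jointHam_qubitEnvironment T.w]
  exact commute_dephasing_jointHam _ _ _

theorem QubitOperation.partialTrace_partialTrace_dephasedUnitary_conj_apply {k : m → ℝ}
    (T : QubitOperation k) {β w : ℝ} (hw : w ≠ 0)
    {σ : Fin (Fintype.card m) → Matrix Bool Bool ℂ}
    (hσ : (qubitEnvironment fun _ : Fin (Fintype.card m) => w).IsThermal β σ)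
    (X : Matrix (m × (T.N → Bool)) (m × (T.N → Bool)) ℂ) (i j : m) :
    partialTrace (partialTrace (T.dephasedUnitary * (X ⊗ₖ tensorProd σ) * T.dephasedUnitaryᴴ)) i j =
      (if i = j then 1 else polarization β w ^ 2 : ℝ) *
        partialTrace (T.unitary * X * T.unitaryᴴ) i j := by
  rw [← partialTrace_partialTrace_dephasing_fst_apply (Fintype.equivFin m).toEmbedding hw hσ,
    dephasedUnitary, Matrix.conjTranspose_mul, ← Matrix.one_mul (tensorProd σ),
    ← Matrix.mul_one (1 * tensorProd σ), Matrix.mul_kronecker_mul, Matrix.mul_kronecker_mul,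
    Matrix.conjTranspose_kronecker, Matrix.conjTranspose_one]
  simp only [Matrix.mul_assoc, Matrix.one_mul, Matrix.mul_one]
  rfl

theorem thermallyPreparable_diagonal (β : ℝ) (k : m → ℝ) {L : Set m} (hL : L.Nonempty) :
    ThermallyPreparable β (Matrix.diagonal fun l => (k l : ℂ))
      {ρ | IsDensityMatrix ρ ∧ ∀ l ∉ L, ρ l l = 0}
      (Matrix.diagonal fun l => (boltzmann L β k l : ℂ)) := by
  intro s hs
  obtain ⟨η, hη, hball⟩ := exists_forall_norm_sub_le_imp_mem hs
  obtain ⟨T, a, ha, haη, hT⟩ := QubitOperation.exists_thermalizesUpTo k β hL hη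
  obtain ⟨w, hw, hpol⟩ := exists_ne_zero_polarization_sq_le β hη
  refine Environment.exists_sum_of_commute (E := qubitEnvironment T.w)
    (F := qubitEnvironment fun _ : Fin (Fintype.card m) => w) T.dephasedUnitary_mem_unitaryGroup
    (T.commute_dephasedUnitary_jointHam _) ?_
  rintro ρ ⟨hρ, hsupp⟩ σ hσ τ hτ
  refine hball _ fun i j => ?_
  rw [T.partialTrace_partialTrace_dephasedUnitary_conj_apply hw hτ]
  by_cases hij : i = j
  · rw [if_pos hij, Complex.ofReal_one, one_mul, hij, Matrix.diagonal_apply_eq]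
    exact (hT.norm_partialTrace_sub_le hL ha hρ hsupp hσ j).trans haη
  · have hdensity := ((hρ.kronecker (isDensityMatrix_tensorProd
      fun i => (hσ i).1)).conj T.unitary_mem_unitaryGroup).partialTrace
    rw [if_neg hij, Matrix.diagonal_apply_ne _ hij, sub_zero, norm_mul, Complex.norm_real,
      Real.norm_of_nonneg (sq_nonneg _)]
    exact (mul_le_of_le_one_right (sq_nonneg _) (hdensity.norm_apply_le_one i j)).trans hpol

end DiagonalPreparation

section SpectralPreparation

variable {m : Type*} [Fintype m] [DecidableEq m]

theorem thermallyPreparable_spectralMatrix {W : Matrix m m ℂ} (hW : W ∈ Matrix.unitaryGroup m ℂ)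
    (β : ℝ) (k : m → ℝ) {L : Set m} (hL : L.Nonempty) :
    ThermallyPreparable β (spectralMatrix W k)
      {ρ | IsDensityMatrix ρ ∧ ∀ l ∉ L, population W ρ l = 0}
      (spectralMatrix W (boltzmann L β k)) := by
  intro s hs
  obtain ⟨E, M, hM, hcomm, hprep⟩ := (thermallyPreparable_diagonal β k hL).conj hW s hs
  refine ⟨E, M, hM, hcomm, fun ρ ⟨hρ, hsupp⟩ => hprep ρ ?_⟩
  have hrotated := hρ.conj (conjTranspose_mem_unitaryGroup hW)
  rw [Matrix.conjTranspose_conjTranspose] at hrotated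
  refine ⟨hrotated, fun l hl => ?_⟩
  rw [← hrotated.ofReal_re_diag]
  exact congrArg _ (hsupp l hl)

theorem thermallyPreparable_kronecker_gibbs (E : Environment) {W : Matrix m m ℂ}
    (hW : W ∈ Matrix.unitaryGroup m ℂ) (β : ℝ) (k : m → ℝ) {L : Set m} (hL : L.Nonempty) :
    ThermallyPreparable β (E.jointHam (spectralMatrix W k))
      {R | ∃ ρ σ, (IsDensityMatrix ρ ∧ ∀ l ∉ L, population W ρ l = 0) ∧
        (∀ i, IsDensityMatrix (σ i)) ∧ R = ρ ⊗ₖ tensorProd σ}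
      (spectralMatrix W (boltzmann L β k) ⊗ₖ tensorProd fun i => gibbs β (E.ham i)) := by
  choose V hV v hv using fun i => exists_eq_spectralMatrix (E.isHermitian_ham i)
  have hgibbs : spectralMatrix W (boltzmann L β k) ⊗ₖ tensorProd (fun i => gibbs β (E.ham i)) =
      spectralMatrix (W ⊗ₖ tensorProd V)
        (boltzmann (Prod.fst ⁻¹' L) β fun x => k x.1 + ∑ i, v i (x.2 i)) := by
    simp only [hv, gibbs_spectralMatrix (hV _)]
    rw [tensorProd_spectralMatrix, kronecker_spectralMatrix,
      boltzmann_fst_preimage L β k fun y : E.Basis => ∑ i, v i (y i), boltzmann_univ_pi]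
  rw [hgibbs, E.jointHam_eq_spectralMatrix hW k hV hv]
  intro s hs
  obtain ⟨F, M, hM, hcomm, hprep⟩ := thermallyPreparable_spectralMatrix
    (Matrix.kronecker_mem_unitary hW (tensorProd_mem_unitaryGroup hV)) β _
    (hL.preimage Prod.fst_surjective) s hs
  refine ⟨F, M, hM, hcomm, ?_⟩
  rintro _ ⟨ρ, σ, ⟨hρ, hsupp⟩, hσ, rfl⟩
  refine hprep _ ⟨hρ.kronecker (isDensityMatrix_tensorProd hσ), fun x hx => ?_⟩
  rw [population_kronecker hW hρ, hsupp x.1 hx, zero_mul]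

end SpectralPreparation

section Reachability

variable {n : Type*} [Fintype n] [DecidableEq n]

theorem meanEnergy_conj_of_commute {M K : Matrix n n ℂ} (hM : M ∈ Matrix.unitaryGroup n ℂ)
    (hcomm : Commute M K) (X : Matrix n n ℂ) : meanEnergy K (M * X * Mᴴ) = meanEnergy K X := by
  rw [meanEnergy, meanEnergy, Matrix.mul_assoc, Matrix.mul_assoc, Matrix.trace_mul_comm,
    Matrix.mul_assoc, Matrix.mul_assoc, ← hcomm.eq, ← Matrix.mul_assoc Mᴴ,
    unitary_conjTranspose_mul hM, Matrix.one_mul]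

theorem achieves_sum_iff {E F : Environment} {H ρ ρf : Matrix n n ℂ} {ε ε' : ℝ}
    {σ : ∀ i, Matrix ((E.sum F).X i) ((E.sum F).X i) ℂ}
    (Y : Matrix ((n × E.Basis) × F.Basis) ((n × E.Basis) × F.Basis) ℂ)
    {X : Matrix ((n × E.Basis) × F.Basis) ((n × E.Basis) × F.Basis) ℂ}
    (hX : (ρ ⊗ₖ tensorProd (X := E.X) fun i => σ (Sum.inl i)) ⊗ₖ
      tensorProd (X := F.X) (fun i => σ (Sum.inr i)) = X) :
    Achieves (E.sum F) H (Y.submatrix (E.jointBasisSum F n) (E.jointBasisSum F n)) ρ σ ρf ε ε' ↔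
      traceNorm (ρf - partialTrace (partialTrace (Y * X * Yᴴ))) ≤ ε ∧
        |meanEnergy (F.jointHam (E.jointHam H)) (Y * X * Yᴴ) -
          meanEnergy (F.jointHam (E.jointHam H)) X| ≤ ε' := by
  rw [Achieves, Environment.conj_kronecker_tensorProd_sum, Environment.kronecker_tensorProd_sum,
    Environment.partialTrace_submatrix_jointBasisSum, Environment.jointHam_sum,
    meanEnergy_submatrix, meanEnergy_submatrix, hX]

theorem meanEnergy_jointHam_conj_sub {E : Environment} {U A A' : Matrix n n ℂ}
    (hU : U ∈ Matrix.unitaryGroup n ℂ) {M : Matrix (n × E.Basis) (n × E.Basis) ℂ}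
    (hM : M ∈ Matrix.unitaryGroup (n × E.Basis) ℂ) (hcomm : Commute M (E.jointHam A'))
    (X : Matrix (n × E.Basis) (n × E.Basis) ℂ) :
    meanEnergy (E.jointHam A) ((U ⊗ₖ 1) * (M * X * Mᴴ) * (U ⊗ₖ 1)ᴴ) -
        meanEnergy (E.jointHam A) X =
      (meanEnergy A (U * partialTrace (M * X * Mᴴ) * Uᴴ) -
        meanEnergy A' (partialTrace (M * X * Mᴴ))) -
      (meanEnergy A (partialTrace X) - meanEnergy A' (partialTrace X)) := by
  have hconserved := meanEnergy_conj_of_commute hM hcomm X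
  have henv := meanEnergy_one_kronecker_conj hU E.totalHam (M * X * Mᴴ)
  rw [Environment.jointHam, meanEnergy_add, meanEnergy_add, meanEnergy_kronecker_one,
    meanEnergy_kronecker_one] at hconserved
  rw [Environment.jointHam, meanEnergy_add, meanEnergy_add, meanEnergy_kronecker_one,
    meanEnergy_kronecker_one, partialTrace_conj_kronecker_one, henv]
  linarith

theorem eventually_traceNorm_lt_and_meanEnergy_lt {z : Type*} [Fintype z] {ρf : Matrix n n ℂ}
    (A K : Matrix (n × z) (n × z) ℂ) {U Ω : Matrix (n × z) (n × z) ℂ} {ε ε' : ℝ}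
    (hstate : traceNorm (ρf - partialTrace (U * Ω * Uᴴ)) < ε) (hε' : 0 < ε') :
    ∀ᶠ D in 𝓝 Ω, traceNorm (ρf - partialTrace (U * D * Uᴴ)) < ε ∧
      |(meanEnergy A (U * D * Uᴴ) - meanEnergy K D) -
        (meanEnergy A (U * Ω * Uᴴ) - meanEnergy K Ω)| < ε' := by
  have hconj : Continuous fun D : Matrix (n × z) (n × z) ℂ => U * D * Uᴴ := by fun_prop
  have hdist : Continuous fun D : Matrix (n × z) (n × z) ℂ =>
      traceNorm (ρf - partialTrace (U * D * Uᴴ)) :=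
    continuous_traceNorm.comp (continuous_const.sub (continuous_partialTrace.comp hconj))
  have henergy : Continuous fun D => meanEnergy A (U * D * Uᴴ) - meanEnergy K D :=
    ((continuous_meanEnergy A).comp hconj).sub (continuous_meanEnergy K)
  exact ((hdist.tendsto Ω).eventually_lt_const hstate).and
    (Metric.continuousAt_iff'.1 henergy.continuousAt ε' hε')

theorem MicReachable.macReachable {β e : ℝ} {H H' γ ρf : Matrix n n ℂ} (hγ : γ ∈ microstates e H)
    (hH' : ∀ ρ ∈ microstates e H, meanEnergy H' ρ = meanEnergy H' γ)
    (hprep : ∀ E : Environment, ThermallyPreparable β (E.jointHam H')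
      {R | ∃ ρ ∈ microstates e H, ∃ σ : ∀ i, Matrix (E.X i) (E.X i) ℂ,
        E.IsThermal β σ ∧ R = ρ ⊗ₖ tensorProd σ}
      (γ ⊗ₖ tensorProd fun i => gibbs β (E.ham i)))
    (h : MicReachable β H γ ρf) : MacReachable β e H ρf := by
  intro ε hε ε' hε'
  obtain ⟨E, U, hU, hstate, henergy⟩ := h (ε / 2) (half_pos hε) (ε' / 2) (half_pos hε')
  set Ω := γ ⊗ₖ tensorProd fun i => gibbs β (E.ham i) with hΩ
  obtain ⟨F, M, hM, hcomm, hMprep⟩ := hprep E _ (eventually_traceNorm_lt_and_meanEnergy_lt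
    (E.jointHam H) (E.jointHam H') (hstate.trans_lt (half_lt_self hε)) (half_pos hε'))
  refine ⟨E.sum F, ((U ⊗ₖ (1 : Matrix F.Basis F.Basis ℂ)) * M).submatrix
    (E.jointBasisSum F n) (E.jointBasisSum F n),
    submatrix_mem_unitaryGroup _ (mul_mem (kronecker_one_mem_unitaryGroup hU) hM),
    fun ρ hρ σ hσ => ?_⟩
  have hσE : E.IsThermal β fun i => σ (Sum.inl i) := Environment.IsThermal.inl hσ
  have hσF : F.IsThermal β fun i => σ (Sum.inr i) := Environment.IsThermal.inr hσ
  obtain ⟨hclose, hdrift⟩ := hMprep _ ⟨ρ, hρ, _, hσE, rfl⟩ _ hσF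
  have htrace : (tensorProd (X := F.X) fun i => σ (Sum.inr i)).trace = 1 :=
    (isDensityMatrix_tensorProd (X := F.X) fun i => (hσF i).1).2
  have hH : meanEnergy (E.jointHam H) (ρ ⊗ₖ tensorProd (X := E.X) fun i => σ (Sum.inl i)) =
      meanEnergy (E.jointHam H) Ω :=
    (hσE.meanEnergy_jointHam hρ).trans ((E.isThermal_gibbs β).meanEnergy_jointHam hγ).symm
  have hK : meanEnergy (E.jointHam H') (ρ ⊗ₖ tensorProd (X := E.X) fun i => σ (Sum.inl i)) =
      meanEnergy (E.jointHam H') Ω :=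
    (hσE.meanEnergy_jointHam ⟨hρ.1, hH' ρ hρ⟩).trans
      ((E.isThermal_gibbs β).meanEnergy_jointHam ⟨hγ.1, rfl⟩).symm
  rw [achieves_sum_iff _ rfl, conj_mul_eq_conj_conj, meanEnergy_jointHam_conj_sub hU hM hcomm,
    partialTrace_conj_kronecker_one, partialTrace_kronecker, htrace, one_smul, hH, hK]
  refine ⟨hclose.le, ?_⟩
  rw [abs_lt] at hdrift
  rw [abs_le] at henergy ⊢
  constructor <;> linarith

theorem MacReachable.micReachable {β e : ℝ} {H γ ρf : Matrix n n ℂ} (hγ : γ ∈ microstates e H)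
    (h : MacReachable β e H ρf) : MicReachable β H γ ρf := fun ε hε ε' hε' => by
  obtain ⟨E, U, hU, hachieves⟩ := h ε hε ε' hε'
  exact ⟨E, U, hU, hachieves γ hγ _ (E.isThermal_gibbs β)⟩

theorem IsCanonicalEnsemble.exists_effectiveHamiltonian {β : ℝ} (hβ : β ≠ 0)
    {e : ℝ} {H γ : Matrix n n ℂ} (hH : H.IsHermitian) (hγ : γ ∈ microstates e H)
    (hcan : IsCanonicalEnsemble e H γ) :
    ∃ H' : Matrix n n ℂ, (∀ ρ ∈ microstates e H, meanEnergy H' ρ = meanEnergy H' γ) ∧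
      ∀ E : Environment, ThermallyPreparable β (E.jointHam H')
        {R | ∃ ρ ∈ microstates e H, ∃ σ : ∀ i, Matrix (E.X i) (E.X i) ℂ,
          E.IsThermal β σ ∧ R = ρ ⊗ₖ tensorProd σ}
        (γ ⊗ₖ tensorProd fun i => gibbs β (E.ham i)) := by
  have := hγ.1.nonempty
  obtain ⟨W, hW, h, rfl⟩ := exists_eq_spectralMatrix hH
  obtain ⟨b, L, hL, hγ_eq, hsupp⟩ := hcan.exists_eq_boltzmann hW
  have hscale (ρ : Matrix n n ℂ) : meanEnergy (spectralMatrix W ((b / β) • h)) ρ =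
      b / β * meanEnergy (spectralMatrix W h) ρ := by
    simp only [meanEnergy_spectralMatrix, Finset.mul_sum, Pi.smul_apply, smul_eq_mul,
      mul_left_comm]
  refine ⟨spectralMatrix W ((b / β) • h), fun ρ hρ => by rw [hscale, hscale, hρ.2, hγ.2],
    fun E s hs => ?_⟩
  rw [hγ_eq, ← mul_div_cancel₀ b hβ, ← boltzmann_smul] at hs
  obtain ⟨F, M, hM, hcomm, hprep⟩ := thermallyPreparable_kronecker_gibbs E hW β _ hL s hs
  refine ⟨F, M, hM, hcomm, ?_⟩
  rintro _ ⟨ρ, hρ, σ, hσ, rfl⟩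
  exact hprep _ ⟨ρ, σ, ⟨hρ.1, hsupp ρ hρ⟩, fun i => (hσ i).1, rfl⟩

end Reachability

theorem theorem1 {n : Type*} [Fintype n] [DecidableEq n] (β : ℝ) (hβ : β ≠ 0)
    (H : Matrix n n ℂ) (hH : H.IsHermitian) (e : ℝ) (he : (microstates e H).Nonempty) :
    (∃ γ : Matrix n n ℂ, IsCanonicalEnsemble e H γ) ∧
      ∀ γ : Matrix n n ℂ, IsCanonicalEnsemble e H γ → OperationallyEquivalent β e H γ := by
  obtain ⟨ρ, hρ⟩ := he
  have := hρ.1.nonempty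
  refine ⟨exists_isCanonicalEnsemble hH ⟨ρ, hρ⟩, fun γ hcan ρf _ => ?_⟩
  have hγ : γ ∈ microstates e H := ⟨hcan.isDensityMatrix hH, hcan.1⟩
  obtain ⟨H', henergy, hprep⟩ := hcan.exists_effectiveHamiltonian hβ hH hγ
  exact ⟨MacReachable.micReachable hγ, MicReachable.macReachable hγ henergy hprep⟩
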